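/- Fix an o-minimal structure on the ordered set $(\mathbb R,<)$; "definable" means definable in it with parameters, and all sets and maps below are definable. The empty set is regarded as connected. A coordinate cone in $\mathbb R^n$ is a set given by conditions $x_j\,\sigma_j\,c_j$ with $\sigma_j\in\{<,=,>\}$, $c_j\in\mathbb R$, at most one for each coordinate $x_j$. A definable open bounded set $X\subset\mathbb R^n$ is *semi-monotone* if $X\cap C$ is connected for every coordinate cone $C$. A bounded upper semi-continuous function $f$ on a non-empty semi-monotone set $X$ is *submonotone* if $\{\mathbf x\in X: f(\mathbf x)<b\}$ is semi-monotone for all $b\in\mathbb R$, and *supermonotone* if $-f$ is submonotone. A definable function $f$ on $X$ is *monotone* if it is both sub- and supermonotone and, for each $j$, it is strictly increasing in $x_j$, strictly decreasing in $x_j$, or independent of $x_j$ (these conditions comparing points of $X$ that differ only in the coordinate $x_j$). Let $\mathbf f=(f_1,\dots,f_k):X\to\mathbb R^k$ be a definable continuous bounded map on a non-empty semi-monotone set $X\subset\mathbb R^n$, $n\ge 1$, with graph $\mathbf F\subset\mathbb R^{n+k}=\operatorname{span}\{x_1,\dots,x_n,y_1,\dots,y_k\}$. A set $H\subset\{x_1,\dots,x_n,y_1,\dots,y_k\}$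 of exactly $n$ coordinates is a *basis set* of $\mathbf f$ if the map $X\to\mathbb R^n$ whose components are the $x_j$ with $x_j\in H$ and the $f_i$ with $y_i\in H$ is injective; the basis sets form the system $\mathbf m$ (matroid) associated with $\mathbf f$. The map $\mathbf f$ is *monotone*, by induction on $n$, if: for $n=1$, every $f_i$ is a monotone function; for $n\ge 2$, whenever $f_i$ is not independent of $x_j$, each non-empty set $\mathbf F\cap\{y_i=b\}$, $b\in\mathbb R$, considered in the space of all coordinates except $y_i$, is the graph of a monotone map $\mathbf f_{i,j,b}$ from a semi-monotone subset of $\operatorname{span}\{x_1,\dots,x_{j-1},x_{j+1},\dots,x_n\}$ to $\operatorname{span}\{y_1,\dots,y_{i-1},x_j,y_{i+1},\dots,y_k\}$, and the system of basis sets of $\mathbf f_{i,j,b}$ is the same for all these $b$. **Theorem.** Let $\mathbf f:X\to\mathbb R^k$ be a monotone map on a non-empty semi-monotone set $X\subset\mathbb R^n$, with graph $\mathbf F\subset\mathbb R^{n+k}$ and associated matroid $\mathbf m$. Let $H$ be a basis set of $\mathbf m$, let $T=\operatorname{span}(H)$, and let $\rho_T:\mathbf F\to T$ be the coordinate projection.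 Then $\rho_T(\mathbf F)\subset T$ is a semi-monotone set, and $\mathbf F$ is the graph of a monotone map from $\rho_T(\mathbf F)$ to the span of the $k$ coordinates not in $H$. -/

import Mathlib

universe u v

namespace MonotoneMaps

/-- An o-minimal structure on the ordered set of real numbers: a first-order structure on `ℝ`
in which the order is definable and every definable subset of `ℝ` is a finite union of points
and intervals.  (The order-connected subsets of `ℝ` are precisely the points and the bounded or
unbounded intervals, together with the empty set.)  "Definable" always means definable with
parameters from `ℝ`. -/
structure IsOMinimal (L : FirstOrder.Language.{u, v}) [L.Structure ℝ] : Prop where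
  definable_lt : (Set.univ : Set ℝ).Definable₂ L {p : ℝ × ℝ | p.1 < p.2}
  finite_union : ∀ s : Set ℝ, (Set.univ : Set ℝ).Definable₁ L s →
    ∃ T : Set (Set ℝ), T.Finite ∧ (∀ t ∈ T, t.OrdConnected) ∧ s = ⋃₀ T

/-- A coordinate cone in `ℝ^α`: at most one condition `x_j < c`, `x_j = c` or `x_j > c` for each
coordinate `x_j`. -/
def IsCoordinateCone {α : Type} (C : Set (α → ℝ)) : Prop :=
  ∃ (J : Finset α) (σ : α → Ordering) (c : α → ℝ),
    C = {x | ∀ j ∈ J, (σ j).Compares (x j) (c j)}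

/-- A (definable) semi-monotone set; the empty set counts as connected. -/
structure IsSemiMonotone (L : FirstOrder.Language.{u, v}) [L.Structure ℝ] {α : Type}
    (X : Set (α → ℝ)) : Prop where
  definable : (Set.univ : Set ℝ).Definable L X
  isOpen : IsOpen X
  bounded : Bornology.IsBounded X
  connected : ∀ C : Set (α → ℝ), IsCoordinateCone C → IsPreconnected (X ∩ C)

/-- The graph of the map `f : X → ℝ^β` as a subset of the space with coordinates
`x_a` (`Sum.inl a`) and `y_b` (`Sum.inr b`).  Here and below, a map on `X` is given by a total
function, of which only the values on `X` matter. -/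
def graph {α β : Type} (X : Set (α → ℝ)) (f : (α → ℝ) → (β → ℝ)) : Set (α ⊕ β → ℝ) :=
  {z | z ∘ Sum.inl ∈ X ∧ z ∘ Sum.inr = f (z ∘ Sum.inl)}

/-- `x` and `y` differ at most in the coordinate `j`. -/
def AgreeOff {α : Type} (j : α) (x y : α → ℝ) : Prop := ∀ l, l ≠ j → x l = y l

def StrictlyIncreasingIn {α : Type} (X : Set (α → ℝ)) (f : (α → ℝ) → ℝ) (j : α) : Prop :=
  ∀ x ∈ X, ∀ y ∈ X, AgreeOff j x y → x j < y j → f x < f y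

def StrictlyDecreasingIn {α : Type} (X : Set (α → ℝ)) (f : (α → ℝ) → ℝ) (j : α) : Prop :=
  ∀ x ∈ X, ∀ y ∈ X, AgreeOff j x y → x j < y j → f y < f x

def IndependentOf {α : Type} (X : Set (α → ℝ)) (f : (α → ℝ) → ℝ) (j : α) : Prop :=
  ∀ x ∈ X, ∀ y ∈ X, AgreeOff j x y → f x = f y

structure IsSubmonotone (L : FirstOrder.Language.{u, v}) [L.Structure ℝ] {α : Type}
    (X : Set (α → ℝ)) (f : (α → ℝ) → ℝ) : Prop where
  nonempty : X.Nonempty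
  domain : IsSemiMonotone L X
  bounded : Bornology.IsBounded (f '' X)
  upperSemicontinuous : UpperSemicontinuousOn f X
  sublevel : ∀ b : ℝ, IsSemiMonotone L {x | x ∈ X ∧ f x < b}

def IsSupermonotone (L : FirstOrder.Language.{u, v}) [L.Structure ℝ] {α : Type}
    (X : Set (α → ℝ)) (f : (α → ℝ) → ℝ) : Prop :=
  IsSubmonotone L X (fun x => - f x)

/-- A monotone (real-valued, definable) function on a non-empty semi-monotone set. -/
structure IsMonotoneFunction (L : FirstOrder.Language.{u, v}) [L.Structure ℝ] {α : Type}
    (X : Set (α → ℝ)) (f : (α → ℝ) → ℝ) : Prop where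
  definable : (Set.univ : Set ℝ).Definable L (graph X (fun x (_ : Unit) => f x))
  submonotone : IsSubmonotone L X f
  supermonotone : IsSupermonotone L X f
  coordinates : ∀ j : α,
    StrictlyIncreasingIn X f j ∨ StrictlyDecreasingIn X f j ∨ IndependentOf X f j

/-- The system of basis sets associated with `f : X → ℝ^β`, `X ⊆ ℝ^α`: the sets `H` of `|α|`
coordinates `x_a`, `y_b` such that the map on `X` whose components are the functions named by the
elements of `H` is injective. -/
def basisSystem {α β : Type} (X : Set (α → ℝ)) (f : (α → ℝ) → (β → ℝ)) :
    Set (Finset (α ⊕ β)) :=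
  {H | H.card = Nat.card α ∧
    Set.InjOn (fun (x : α → ℝ) (h : {c // c ∈ H}) => Sum.elim x (f x) h.1) X}

/-- The renaming of coordinates for the exchange of `x_j` and `y_i`: the coordinates
`x_a`, `a ≠ j`, keep their names, `x_j` takes the place of `y_i`, and the remaining `y_l` stay. -/
noncomputable def exchangeLabel {α β : Type} (i : β) (j : α) : {a : α // a ≠ j} ⊕ β → α ⊕ β :=
  open Classical in
  Sum.elim (fun a => Sum.inl a.1) (Function.update Sum.inr i (Sum.inl j))

/-- The set `F ∩ {y_i = b}`, considered as a set in the space with domain coordinates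
`x_a`, `a ≠ j`, and with value coordinates `y_l`, `l ≠ i`, and `x_j` (in the place of `y_i`). -/
def levelSlice {α β : Type} (F : Set (α ⊕ β → ℝ)) (i : β) (j : α) (b : ℝ) :
    Set ({a : α // a ≠ j} ⊕ β → ℝ) :=
  (fun z => z ∘ exchangeLabel i j) '' {z | z ∈ F ∧ z (Sum.inr i) = b}

/-- A (definable) continuous bounded map on a non-empty semi-monotone set. -/
structure IsBoundedContinuousMap (L : FirstOrder.Language.{u, v}) [L.Structure ℝ] {α β : Type}
    (X : Set (α → ℝ)) (f : (α → ℝ) → (β → ℝ)) : Prop where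
  nonempty : X.Nonempty
  domain : IsSemiMonotone L X
  definable : (Set.univ : Set ℝ).Definable L (graph X f)
  continuous : ContinuousOn f X
  bounded : Bornology.IsBounded (f '' X)

/-- Monotone maps on subsets of an `n`-dimensional coordinate space, by induction on `n ≥ 1`.
In the inductive step the common system `m` of basis sets expresses that the system of the map
whose graph is the level slice does not depend on `b`. -/
def IsMonotoneMapOfDim (L : FirstOrder.Language.{u, v}) [L.Structure ℝ] {β : Type} :
    ℕ → ∀ {α : Type}, Set (α → ℝ) → ((α → ℝ) → (β → ℝ)) → Prop
  | 0, _, _, _ => False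
  | 1, _, X, f =>
      IsBoundedContinuousMap L X f ∧ ∀ i : β, IsMonotoneFunction L X (fun x => f x i)
  | n + 2, α, X, f =>
      IsBoundedContinuousMap L X f ∧
      ∀ (i : β) (j : α), ¬ IndependentOf X (fun x => f x i) j →
        ∃ m : Set (Finset ({a : α // a ≠ j} ⊕ β)), ∀ b : ℝ,
          (levelSlice (graph X f) i j b).Nonempty →
          ∃ (X' : Set ({a : α // a ≠ j} → ℝ)) (f' : ({a : α // a ≠ j} → ℝ) → (β → ℝ)),
            IsMonotoneMapOfDim L (n + 1) X' f' ∧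
            graph X' f' = levelSlice (graph X f) i j b ∧
            basisSystem X' f' = m

/-- `f : X → ℝ^β`, `X ⊆ ℝ^α` non-empty and semi-monotone, is a monotone map. -/
def IsMonotoneMap (L : FirstOrder.Language.{u, v}) [L.Structure ℝ] {α β : Type}
    (X : Set (α → ℝ)) (f : (α → ℝ) → (β → ℝ)) : Prop :=
  IsMonotoneMapOfDim L (Nat.card α) X f

/-- The projection to `span I` of a set in a space with coordinates indexed by `γ`. -/
def proj {γ : Type} (I : Finset γ) (F : Set (γ → ℝ)) : Set ({c // c ∈ I} → ℝ) :=
  (fun z c => z c.1) '' F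

end MonotoneMaps

namespace MonotoneMaps

open Set Filter Topology

section Line

/-- An injective continuous function on `[-ε, ε]` takes its value at `0` strictly between the
values at `-δ` and `δ`, always in the same order. -/
lemma straddle_of_injOn {ε : ℝ} (hε : 0 < ε) {φ : ℝ → ℝ} (hc : ContinuousOn φ (Icc (-ε) ε))
    (hi : InjOn φ (Icc (-ε) ε)) :
    (∀ δ, 0 < δ → δ ≤ ε → φ (-δ) < φ 0 ∧ φ 0 < φ δ) ∨
      (∀ δ, 0 < δ → δ ≤ ε → φ δ < φ 0 ∧ φ 0 < φ (-δ)) := by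
  rcases hc.strictMonoOn_of_injOn_Icc' (by linarith) hi with h | h
  · left
    intro δ h0 h1
    exact ⟨h ⟨by linarith, by linarith⟩ ⟨by linarith, by linarith⟩ (by linarith),
      h ⟨by linarith, by linarith⟩ ⟨by linarith, by linarith⟩ (by linarith)⟩
  · right
    intro δ h0 h1
    exact ⟨h ⟨by linarith, by linarith⟩ ⟨by linarith, by linarith⟩ (by linarith),
      h ⟨by linarith, by linarith⟩ ⟨by linarith, by linarith⟩ (by linarith)⟩

lemma exists_pos_Icc_subset {U : Set ℝ} (hU : U ∈ 𝓝 (0 : ℝ)) {ε : ℝ} (hε : 0 < ε) :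
    ∃ δ, 0 < δ ∧ δ ≤ ε ∧ Icc (-δ) δ ⊆ U := by
  obtain ⟨r, hr, h⟩ := Metric.nhds_basis_closedBall.mem_iff.1 hU
  refine ⟨min r ε, lt_min hr hε, min_le_right _ _, fun x hx => h ?_⟩
  rw [Metric.mem_closedBall, Real.dist_eq, sub_zero, abs_le]
  have := min_le_left r ε
  exact ⟨by linarith [hx.1], by linarith [hx.2]⟩

lemma image_mem_nhds_of_injOn {ε : ℝ} (hε : 0 < ε) {φ : ℝ → ℝ}
    (hc : ContinuousOn φ (Icc (-ε) ε)) (hi : InjOn φ (Icc (-ε) ε)) {U : Set ℝ}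
    (hU : U ∈ 𝓝 (0 : ℝ)) : φ '' (Icc (-ε) ε ∩ U) ∈ 𝓝 (φ 0) := by
  obtain ⟨δ, h0, h1, h2⟩ := exists_pos_Icc_subset hU hε
  have hsub : Icc (-δ) δ ⊆ Icc (-ε) ε := Icc_subset_Icc (by linarith) h1
  have hsub' : Icc (-δ) δ ⊆ Icc (-ε) ε ∩ U := fun x hx => ⟨hsub hx, h2 hx⟩
  rcases straddle_of_injOn hε hc hi with h | h
  · obtain ⟨ha, hb⟩ := h δ h0 h1
    exact mem_of_superset (Icc_mem_nhds ha hb)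
      ((intermediate_value_Icc (by linarith) (hc.mono hsub)).trans (image_mono hsub'))
  · obtain ⟨ha, hb⟩ := h δ h0 h1
    exact mem_of_superset (Icc_mem_nhds ha hb)
      ((intermediate_value_Icc' (by linarith) (hc.mono hsub)).trans (image_mono hsub'))

lemma not_isLocalExtr_of_injOn {ε : ℝ} (hε : 0 < ε) {φ : ℝ → ℝ}
    (hc : ContinuousOn φ (Icc (-ε) ε)) (hi : InjOn φ (Icc (-ε) ε)) : ¬ IsLocalExtr φ 0 := by
  rintro (h | h)
  · obtain ⟨δ, h0, h1, h2⟩ := exists_pos_Icc_subset h hε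
    have hn : φ 0 ≤ φ (-δ) := h2 ⟨le_rfl, by linarith⟩
    have hp : φ 0 ≤ φ δ := h2 ⟨by linarith, le_rfl⟩
    rcases straddle_of_injOn hε hc hi with h | h
    · linarith [(h δ h0 h1).1]
    · linarith [(h δ h0 h1).1]
  · obtain ⟨δ, h0, h1, h2⟩ := exists_pos_Icc_subset h hε
    have hn : φ (-δ) ≤ φ 0 := h2 ⟨le_rfl, by linarith⟩
    have hp : φ δ ≤ φ 0 := h2 ⟨by linarith, le_rfl⟩
    rcases straddle_of_injOn hε hc hi with h | h
    · linarith [(h δ h0 h1).2]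
    · linarith [(h δ h0 h1).2]

/-- If a function on a preconnected set is open and has preconnected level sets, then the
preimage of an open interval is preconnected. -/
lemma isPreconnected_inter_preimage {E : Type*} [TopologicalSpace E] {Z : Set E} {φ : E → ℝ}
    (hZ : IsPreconnected Z) (hφ : Continuous φ)
    (hfib : ∀ b, IsPreconnected (Z ∩ {z | φ z = b}))
    (hopen : ∀ z ∈ Z, ∀ U ∈ 𝓝 z, φ '' (Z ∩ U) ∈ 𝓝 (φ z))
    {T : Set ℝ} (hT : IsOpen T) (hT' : T.OrdConnected) :
    IsPreconnected (Z ∩ φ ⁻¹' T) := by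
  intro u v hu hv huv hnu hnv
  have himg : ∀ u : Set E, IsOpen u → IsOpen (φ '' (Z ∩ φ ⁻¹' T ∩ u)) := by
    intro u hu
    rw [isOpen_iff_mem_nhds]
    rintro _ ⟨z, ⟨⟨hz, hzT⟩, hzu⟩, rfl⟩
    refine mem_of_superset (hopen z hz (φ ⁻¹' T ∩ u)
      (inter_mem ((hT.preimage hφ).mem_nhds hzT) (hu.mem_nhds hzu))) (image_mono ?_)
    rintro x ⟨h1, h2, h3⟩
    exact ⟨⟨h1, h2⟩, h3⟩
  have hI : IsPreconnected (φ '' Z ∩ T) := by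
    have h1 : (φ '' Z).OrdConnected := (hZ.image φ hφ.continuousOn).ordConnected
    exact (h1.inter hT').isPreconnected
  have hcover : φ '' Z ∩ T ⊆ φ '' (Z ∩ φ ⁻¹' T ∩ u) ∪ φ '' (Z ∩ φ ⁻¹' T ∩ v) := by
    rintro _ ⟨⟨z, hz, rfl⟩, hzT⟩
    rcases huv ⟨hz, hzT⟩ with h | h
    · exact Or.inl ⟨z, ⟨⟨hz, hzT⟩, h⟩, rfl⟩
    · exact Or.inr ⟨z, ⟨⟨hz, hzT⟩, h⟩, rfl⟩
  obtain ⟨a, ha⟩ := hnu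
  obtain ⟨b, hb⟩ := hnv
  obtain ⟨t, -, ⟨x, hx, hxt⟩, ⟨y, hy, hyt⟩⟩ := hI _ _ (himg u hu) (himg v hv) hcover
    ⟨φ a, ⟨⟨a, ha.1.1, rfl⟩, ha.1.2⟩, ⟨a, ha, rfl⟩⟩ ⟨φ b, ⟨⟨b, hb.1.1, rfl⟩, hb.1.2⟩, ⟨b, hb, rfl⟩⟩
  have htT : t ∈ T := hxt ▸ hx.1.2
  have hsub : Z ∩ {z | φ z = t} ⊆ Z ∩ φ ⁻¹' T := by
    rintro z ⟨h1, h2⟩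
    refine ⟨h1, ?_⟩
    rw [mem_preimage, show φ z = t from h2]
    exact htT
  obtain ⟨z, hz, hz'⟩ := hfib t u v hu hv (hsub.trans huv) ⟨x, ⟨hx.1.1, hxt⟩, hx.2⟩
    ⟨y, ⟨hy.1.1, hyt⟩, hy.2⟩
  exact ⟨z, hsub hz, hz'⟩

end Line

section Chart

variable {γ : Type} {S T H : Finset γ} {F : Set (γ → ℝ)}

/-- `z` and `w` have the same coordinates in `S`. -/
def Agree (S : Finset γ) (z w : γ → ℝ) : Prop := ∀ c ∈ S, z c = w c

lemma Agree.symm {z w : γ → ℝ} (h : Agree S z w) : Agree S w z := fun c hc => (h c hc).symm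

lemma Agree.trans {x y z : γ → ℝ} (h : Agree S x y) (h' : Agree S y z) : Agree S x z :=
  fun c hc => (h c hc).trans (h' c hc)

lemma Agree.mono {z w : γ → ℝ} (h : Agree S z w) (hT : T ⊆ S) : Agree T z w :=
  fun c hc => h c (hT hc)

/-- The coordinates in `H` separate the points of `F`. -/
def Separates (H : Finset γ) (F : Set (γ → ℝ)) : Prop :=
  ∀ z ∈ F, ∀ w ∈ F, Agree H z w → z = w

/-- The part of `F` where the coordinate `i` has the value `b`. -/
def level (F : Set (γ → ℝ)) (i : γ) (b : ℝ) : Set (γ → ℝ) := {z | z ∈ F ∧ z i = b}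

lemma level_comm (F : Set (γ → ℝ)) (i j : γ) (b c : ℝ) :
    level (level F i b) j c = level (level F j c) i b := by
  ext z
  simp only [level, mem_ofPred_eq]
  tauto

lemma Separates.subset {G : Set (γ → ℝ)} (h : Separates H F) (hG : G ⊆ F) : Separates H G :=
  fun z hz w hw => h z (hG hz) w (hG hw)

lemma level_subset (F : Set (γ → ℝ)) (i : γ) (b : ℝ) : level F i b ⊆ F := fun _ h => h.1

/-- `F` is the graph of a continuous map on an open subset of `span S`, of which the intersections
with coordinate cones are connected. -/
structure IsChart (S : Finset γ) (F : Set (γ → ℝ)) : Prop where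
  nonempty : F.Nonempty
  separates : Separates S F
  isOpen : ∀ z ∈ F, ∀ U ∈ 𝓝 z, ∀ᶠ x in 𝓝 z, ∃ w ∈ F ∩ U, Agree S w x
  connected : ∀ (J : Finset γ) (σ : γ → Ordering) (c : γ → ℝ), J ⊆ S →
    IsPreconnected (F ∩ {x | ∀ j ∈ J, (σ j).Compares (x j) (c j)})

lemma IsChart.isOpen_of_agree [DecidableEq γ] (h : IsChart S F) {w x : γ → ℝ} (hw : w ∈ F)
    (hx : Agree S w x) {U : Set (γ → ℝ)} (hU : U ∈ 𝓝 w) :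
    ∀ᶠ y in 𝓝 x, ∃ w' ∈ F ∩ U, Agree S w' y := by
  have ht : Tendsto (fun y : γ → ℝ => fun c => if c ∈ S then y c else w c) (𝓝 x) (𝓝 w) := by
    have hcont : Continuous (fun y : γ → ℝ => fun c => if c ∈ S then y c else w c) := by
      refine continuous_pi fun c => ?_
      by_cases hc : c ∈ S
      · simpa [hc] using continuous_apply c
      · simpa [hc] using continuous_const
    have := hcont.tendsto x
    convert this using 2
    funext c
    by_cases hc : c ∈ S
    · simp [hc, hx c hc]
    · simp [hc]
  filter_upwards [ht.eventually (h.isOpen w hw U hU)] with y hy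
  obtain ⟨w', hw', ha⟩ := hy
  refine ⟨w', hw', fun c hc => ?_⟩
  simpa [hc] using ha c hc

/-- A chart has a continuous inverse, defined on the cylinder over its domain. -/
lemma IsChart.exists_lift [DecidableEq γ] (h : IsChart S F) :
    ∃ (g : (γ → ℝ) → (γ → ℝ)) (V : Set (γ → ℝ)), IsOpen V ∧ ContinuousOn g V ∧
      (∀ x ∈ V, g x ∈ F ∧ Agree S (g x) x) ∧
      ∀ x, ∀ w ∈ F, Agree S w x → x ∈ V ∧ g x = w := by
  classical
  let V : Set (γ → ℝ) := {x | ∃ w ∈ F, Agree S w x}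
  let g : (γ → ℝ) → (γ → ℝ) := fun x => if hx : x ∈ V then hx.choose else 0
  have hg : ∀ x ∈ V, g x ∈ F ∧ Agree S (g x) x := by
    intro x hx
    have := hx.choose_spec
    simpa [g, hx] using this
  have hu : ∀ x, ∀ w ∈ F, Agree S w x → x ∈ V ∧ g x = w := by
    intro x w hw ha
    have hx : x ∈ V := ⟨w, hw, ha⟩
    exact ⟨hx, h.separates _ (hg x hx).1 _ hw ((hg x hx).2.trans ha.symm)⟩
  have hV : IsOpen V := by
    rw [isOpen_iff_mem_nhds]
    rintro x ⟨w, hw, ha⟩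
    filter_upwards [h.isOpen_of_agree hw ha univ_mem] with y hy
    obtain ⟨w', hw', ha'⟩ := hy
    exact ⟨w', hw'.1, ha'⟩
  refine ⟨g, V, hV, ?_, hg, hu⟩
  intro x hx
  refine ContinuousAt.continuousWithinAt ?_
  intro U hU
  rw [mem_map]
  filter_upwards [h.isOpen_of_agree (hg x hx).1 (hg x hx).2 hU] with y hy
  obtain ⟨w', hw', ha'⟩ := hy
  change g y ∈ U
  rw [(hu y w' hw'.1 ha').2]
  exact hw'.2

lemma IsChart.preconnected_agree (h : IsChart S F) (hT : T ⊆ S) (p : γ → ℝ) :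
    IsPreconnected {z | z ∈ F ∧ Agree T z p} := by
  have := h.connected T (fun _ => Ordering.eq) p hT
  simpa [Ordering.Compares, Agree, ofPred_and] using this

variable [DecidableEq γ]

/-- Two points of `F` that agree in `S` except in the coordinate `j` may differ in the
coordinate `i`. -/
def DependsOn (S : Finset γ) (F : Set (γ → ℝ)) (i j : γ) : Prop :=
  ∃ z ∈ F, ∃ w ∈ F, Agree (S.erase j) z w ∧ z i ≠ w i

/-- A segment in a chart parallel to the coordinate axis `j`. -/
lemma IsChart.exists_segment (h : IsChart S F) {j : γ} (hj : j ∈ S) {p : γ → ℝ} (hp : p ∈ F) :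
    ∃ ε > 0, ∃ s : ℝ → (γ → ℝ), ContinuousOn s (Icc (-ε) ε) ∧ s 0 = p ∧
      ∀ t ∈ Icc (-ε) ε, s t ∈ F ∧ s t j = p j + t ∧ Agree (S.erase j) (s t) p := by
  obtain ⟨g, V, hV, hgc, hg, hu⟩ := h.exists_lift
  have hcont : Continuous fun t : ℝ => Function.update p j (p j + t) :=
    continuous_const.update j (by fun_prop)
  have hpV := hu p p hp (fun _ _ => rfl)
  have hnb : (fun t : ℝ => Function.update p j (p j + t)) ⁻¹' V ∈ 𝓝 (0 : ℝ) :=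
    hcont.continuousAt.preimage_mem_nhds (hV.mem_nhds (by simpa using hpV.1))
  obtain ⟨ε, hε, -, hsub⟩ := exists_pos_Icc_subset hnb one_pos
  refine ⟨ε, hε, fun t => g (Function.update p j (p j + t)),
    hgc.comp hcont.continuousOn hsub, by simpa using hpV.2, fun t ht => ?_⟩
  obtain ⟨h1, h2⟩ := hg _ (hsub ht)
  refine ⟨h1, by simpa using h2 j hj, fun c hc => ?_⟩
  have := h2 c (Finset.mem_of_mem_erase hc)
  simpa [Function.update_of_ne (Finset.ne_of_mem_erase hc)] using this

/-- `i` separates points on the lines parallel to the axis `j`. -/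
lemma injOn_segment {i j : γ} (hs : Separates (insert i (S.erase j)) F) {s : ℝ → (γ → ℝ)}
    {p : γ → ℝ} {I : Set ℝ}
    (h : ∀ t ∈ I, s t ∈ F ∧ s t j = p j + t ∧ Agree (S.erase j) (s t) p) :
    InjOn (fun t => s t i) I := by
  intro t ht t' ht' he
  obtain ⟨h1, h2, h3⟩ := h t ht
  obtain ⟨h1', h2', h3'⟩ := h t' ht'
  have : s t = s t' := by
    refine hs _ h1 _ h1' fun c hc => ?_
    rcases Finset.mem_insert.1 hc with rfl | hc
    · exact he
    · exact (h3.trans h3'.symm) c hc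
  rw [this] at h2
  linarith

lemma IsChart.image_mem_nhds (h : IsChart S F) {i j : γ} (hj : j ∈ S)
    (hs : Separates (insert i (S.erase j)) F) {p : γ → ℝ} (hp : p ∈ F)
    {U : Set (γ → ℝ)} (hU : U ∈ 𝓝 p) :
    (fun z : γ → ℝ => z i) '' {z | z ∈ F ∧ Agree (S.erase j) z p ∧ z ∈ U} ∈ 𝓝 (p i) := by
  obtain ⟨ε, hε, s, hsc, hs0, hst⟩ := h.exists_segment hj hp
  have hc : ContinuousOn (fun t => s t i) (Icc (-ε) ε) :=
    (continuous_apply i).comp_continuousOn hsc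
  have hU' : s ⁻¹' U ∈ 𝓝 (0 : ℝ) := by
    have : ContinuousAt s 0 := hsc.continuousAt (Icc_mem_nhds (by linarith) hε)
    exact this.preimage_mem_nhds (by rwa [hs0])
  have := image_mem_nhds_of_injOn hε hc (injOn_segment hs hst) hU'
  simp only [hs0] at this
  refine mem_of_superset this ?_
  rintro _ ⟨t, ⟨ht, htU⟩, rfl⟩
  exact ⟨s t, ⟨(hst t ht).1, (hst t ht).2.2, htU⟩, rfl⟩

/-- Suppose that on the plane through `p` parallel to the axes `j` and `l` the coordinate `v` is a
function of the coordinate `u`, and that both are injective on the lines parallel to `j`. Then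
this function is injective. -/
lemma IsChart.eq_of_eq_of_plane (h : IsChart S F) {j l u v : γ} (hj : j ∈ S)
    (hsu : Separates (insert u (S.erase j)) F) (hsv : Separates (insert v (S.erase j)) F)
    {p : γ → ℝ}
    (huv : ∀ z ∈ F, ∀ w ∈ F, Agree ((S.erase j).erase l) z p → Agree ((S.erase j).erase l) w p →
      z u = w u → z v = w v)
    {a b : γ → ℝ} (ha : a ∈ F) (hb : b ∈ F) (hap : Agree ((S.erase j).erase l) a p)
    (hbp : Agree ((S.erase j).erase l) b p) (hab : a v = b v) : a u = b u := by
  classical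
  by_contra hne
  wlog hlt : a u < b u generalizing a b
  · exact this hb ha hbp hap hab.symm (Ne.symm hne) (lt_of_le_of_ne (not_lt.1 hlt) (Ne.symm hne))
  set Y : Set (γ → ℝ) := {z | z ∈ F ∧ Agree ((S.erase j).erase l) z p} with hY
  have hYc : IsPreconnected Y :=
    h.preconnected_agree ((Finset.erase_subset _ _).trans (Finset.erase_subset _ _)) p
  have hI : ((fun z : γ → ℝ => z u) '' Y).OrdConnected :=
    (hYc.image _ (continuous_apply u).continuousOn).ordConnected
  have hIcc : Icc (a u) (b u) ⊆ (fun z : γ → ℝ => z u) '' Y :=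
    hI.out ⟨a, ⟨ha, hap⟩, rfl⟩ ⟨b, ⟨hb, hbp⟩, rfl⟩
  obtain ⟨φ, hφ⟩ : ∃ φ : ℝ → ℝ, ∀ z ∈ Y, φ (z u) = z v := by
    refine ⟨fun x => if hx : x ∈ (fun z : γ → ℝ => z u) '' Y then hx.choose v else 0,
      fun z hz => ?_⟩
    have hx : z u ∈ (fun z : γ → ℝ => z u) '' Y := ⟨z, hz, rfl⟩
    obtain ⟨h1, h2⟩ := hx.choose_spec
    simp only [hx, dif_pos]
    exact huv _ h1.1 _ hz.1 h1.2 hz.2 h2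
  have hline : ∀ y ∈ Y, ∀ z, Agree (S.erase j) z y → z ∈ F → z ∈ Y := fun y hy z hz hzF =>
    ⟨hzF, (hz.mono (Finset.erase_subset _ _)).trans hy.2⟩
  have hφc : ContinuousOn φ (Icc (a u) (b u)) := by
    intro x hx
    obtain ⟨y, hy, rfl⟩ := hIcc hx
    refine ContinuousAt.continuousWithinAt ?_
    intro W hW
    simp only [hφ y hy] at hW
    have hU : (fun z : γ → ℝ => z v) ⁻¹' W ∈ 𝓝 y :=
      (continuous_apply v).continuousAt.preimage_mem_nhds hW
    rw [mem_map]
    refine mem_of_superset (h.image_mem_nhds hj hsu hy.1 hU) ?_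
    rintro _ ⟨z, ⟨hzF, hzy, hzW⟩, rfl⟩
    have hz := hline y hy z hzy hzF
    simpa [hφ z hz] using hzW
  obtain ⟨x, hx, hext⟩ := exists_isLocalExtr_Ioo hlt hφc
    (by rw [hφ a ⟨ha, hap⟩, hφ b ⟨hb, hbp⟩, hab])
  obtain ⟨y, hy, rfl⟩ := hIcc (Ioo_subset_Icc_self hx)
  obtain ⟨ε, hε, s, hsc, hs0, hst⟩ := h.exists_segment hj hy.1
  have hcu : ContinuousOn (fun t => s t u) (Icc (-ε) ε) :=
    (continuous_apply u).comp_continuousOn hsc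
  have hcv : ContinuousOn (fun t => s t v) (Icc (-ε) ε) :=
    (continuous_apply v).comp_continuousOn hsc
  have hnb : Icc (-ε) ε ∈ 𝓝 (0 : ℝ) := Icc_mem_nhds (by linarith) hε
  refine not_isLocalExtr_of_injOn hε hcv (injOn_segment hsv hst) ?_
  have hev : ∀ t ∈ Icc (-ε) ε, φ (s t u) = s t v := fun t ht =>
    hφ _ (hline y hy _ (hst t ht).2.2 (hst t ht).1)
  have htend : Tendsto (fun t => s t u) (𝓝 0) (𝓝 (y u)) := by
    have := (hcu.continuousAt hnb).tendsto
    simpa [hs0] using this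
  have h0 : s 0 v = φ (y u) := by rw [hs0, hφ y hy]
  rcases hext with hm | hm
  · left
    change ∀ᶠ t in 𝓝 (0 : ℝ), s 0 v ≤ s t v
    filter_upwards [hnb, htend.eventually hm] with t ht hmt
    rw [h0, ← hev t ht]
    exact hmt
  · right
    change ∀ᶠ t in 𝓝 (0 : ℝ), s t v ≤ s 0 v
    filter_upwards [hnb, htend.eventually hm] with t ht hmt
    rw [h0, ← hev t ht]
    exact hmt

/-- A coordinate that depends on no coordinate in `T` is constant along `T`. -/
lemma IsChart.eq_of_not_dependsOn (h : IsChart S F) {c : γ}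
    (hc : ∀ j ∈ T, ¬ DependsOn S F c j) {a b : γ → ℝ} (ha : a ∈ F) (hb : b ∈ F)
    (hab : Agree (S \ T) a b) : a c = b c := by
  set Y : Set (γ → ℝ) := {z | z ∈ F ∧ Agree (S \ T) z a} with hY
  have hYc : IsPreconnected Y := h.preconnected_agree Finset.sdiff_subset a
  obtain ⟨g, V, hV, hgc, hg, hu⟩ := h.exists_lift
  have hloc : ∀ y ∈ Y, ∀ᶠ z in 𝓝[Y] y, z c = y c := by
    intro y hy
    have key : ∀ T' ⊆ T, ∀ᶠ z in 𝓝 y, (g (fun d => if d ∈ T' then z d else y d)) c = y c := by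
      intro T'
      induction T' using Finset.induction_on with
      | empty =>
        intro _
        refine Eventually.of_forall fun z => ?_
        simp [(hu y y hy.1 (fun _ _ => rfl)).2]
      | insert d T' hd ih =>
        intro hsub
        have hcT : ∀ T'' : Finset γ, ∀ᶠ z in 𝓝 y, (fun e => if e ∈ T'' then z e else y e) ∈ V := by
          intro T''
          have hcont : Continuous (fun z : γ → ℝ => fun e => if e ∈ T'' then z e else y e) := by
            refine continuous_pi fun e => ?_
            by_cases he : e ∈ T''
            · simpa [he] using continuous_apply e
            · simpa [he] using continuous_const
          refine hcont.continuousAt.preimage_mem_nhds (hV.mem_nhds ?_)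
          simpa using (hu y y hy.1 (fun _ _ => rfl)).1
        filter_upwards [ih ((Finset.subset_insert _ _).trans hsub), hcT T', hcT (insert d T')]
          with z hz h1 h2
        rw [← hz]
        have hnd := hc d (hsub (Finset.mem_insert_self _ _))
        by_contra hne
        refine hnd ⟨_, (hg _ h2).1, _, (hg _ h1).1, fun e he => ?_, hne⟩
        have heS := Finset.mem_of_mem_erase he
        rw [(hg _ h2).2 e heS, (hg _ h1).2 e heS]
        simp [Finset.mem_insert, Finset.ne_of_mem_erase he]
    have hk := key T subset_rfl
    rw [eventually_nhdsWithin_iff]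
    filter_upwards [hk] with z hz hzY
    rw [← hz]
    refine congrFun (Eq.symm (hu _ z hzY.1 fun d hd => ?_).2) c
    by_cases hdT : d ∈ T
    · simp [hdT]
    · simpa [hdT] using (hzY.2.trans hy.2.symm) d (Finset.mem_sdiff.2 ⟨hd, hdT⟩)
  exact hYc.induction₂ (fun y z => z c = y c) hloc (fun x y z _ _ _ h1 h2 => h2.trans h1)
    (fun x y _ _ h1 => h1.symm) ⟨hb, hab.symm⟩ ⟨ha, fun _ _ => rfl⟩

end Chart

section Monotone

variable {γ : Type} [DecidableEq γ] {S H : Finset γ} {F : Set (γ → ℝ)}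

lemma IsChart.separates_self (h : IsChart S F) {j : γ} (hj : j ∈ S) :
    Separates (insert j (S.erase j)) F := by
  rw [Finset.insert_erase hj]
  exact h.separates

lemma IsChart.exists_ne (h : IsChart S F) {j : γ} (hj : j ∈ S) {p : γ → ℝ} (hp : p ∈ F) :
    ∃ q ∈ F, q ≠ p ∧ Agree (S.erase j) q p := by
  obtain ⟨ε, hε, s, -, -, hs⟩ := h.exists_segment hj hp
  obtain ⟨h1, h2, h3⟩ := hs ε ⟨by linarith, le_rfl⟩
  refine ⟨_, h1, fun he => ?_, h3⟩
  rw [he] at h2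
  linarith

lemma IsChart.dependsOn_of_separates (h : IsChart S F) {i j : γ} (hj : j ∈ S)
    (hs : Separates (insert i (S.erase j)) F) : DependsOn S F i j := by
  obtain ⟨p, hp⟩ := h.nonempty
  obtain ⟨q, hq, hne, ha⟩ := h.exists_ne hj hp
  refine ⟨q, hq, p, hp, ha, fun he => hne (hs q hq p hp fun c hc => ?_)⟩
  rcases Finset.mem_insert.1 hc with rfl | hc
  · exact he
  · exact ha c hc

/-- The intersection of a chart with a coordinate hyperplane `x_j = b`, where `j ∈ S`. -/
lemma IsChart.level (h : IsChart S F) {j : γ} (hj : j ∈ S) {b : ℝ}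
    (hne : (level F j b).Nonempty) : IsChart (S.erase j) (level F j b) where
  nonempty := hne
  separates := by
    intro z hz w hw ha
    refine h.separates z hz.1 w hw.1 fun c hc => ?_
    by_cases hcj : c = j
    · subst hcj
      exact hz.2.trans hw.2.symm
    · exact ha c (Finset.mem_erase.2 ⟨hcj, hc⟩)
  isOpen := by
    intro z hz U hU
    have hcont : Continuous fun x : γ → ℝ => Function.update x j b :=
      continuous_id.update j continuous_const
    have ht : Tendsto (fun x : γ → ℝ => Function.update x j b) (𝓝 z) (𝓝 z) := by
      have := hcont.tendsto z
      rwa [show Function.update z j b = z by rw [← hz.2]; simp] at this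
    filter_upwards [ht.eventually (h.isOpen z hz.1 U hU)] with x hx
    obtain ⟨w, hw, ha⟩ := hx
    refine ⟨w, ⟨⟨hw.1, by simpa using ha j hj⟩, hw.2⟩, fun c hc => ?_⟩
    simpa [Function.update_of_ne (Finset.ne_of_mem_erase hc)] using
      ha c (Finset.mem_of_mem_erase hc)
  connected := by
    intro J σ c hJ
    have hjJ : j ∉ J := fun hm => Finset.notMem_erase j S (hJ hm)
    have := h.connected (insert j J) (Function.update σ j Ordering.eq) (Function.update c j b)
      (Finset.insert_subset hj (hJ.trans (Finset.erase_subset _ _)))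
    convert this using 1
    ext x
    have hne : ∀ i ∈ J, i ≠ j := fun i hi he => hjJ (he ▸ hi)
    constructor
    · rintro ⟨⟨h1, h2⟩, h3⟩
      refine ⟨h1, fun i hi => ?_⟩
      rcases Finset.mem_insert.1 hi with rfl | hi
      · simpa [Ordering.Compares] using h2
      · simpa [Function.update_of_ne (hne i hi)] using h3 i hi
    · rintro ⟨h1, h3⟩
      refine ⟨⟨h1, ?_⟩, fun i hi => ?_⟩
      · simpa [Ordering.Compares] using h3 j (Finset.mem_insert_self _ _)
      · simpa [Function.update_of_ne (hne i hi)] using h3 i (Finset.mem_insert_of_mem hi)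

/-- The exchange of a coordinate `j ∈ S` for a coordinate `i` with connected level sets. -/
lemma IsChart.exchange (h : IsChart S F) {i j : γ} (hj : j ∈ S)
    (hs : Separates (insert i (S.erase j)) F)
    (hl : ∀ b, (MonotoneMaps.level F i b).Nonempty →
      IsChart (S.erase j) (MonotoneMaps.level F i b)) :
    IsChart (insert i (S.erase j)) F where
  nonempty := h.nonempty
  separates := hs
  isOpen := by
    intro z hz U hU
    obtain ⟨g, V, hV, hgc, hg, hu⟩ := h.exists_lift
    have hzV := hu z z hz fun _ _ => rfl
    let ψ : (γ → ℝ) × ℝ → (γ → ℝ) := fun q => Function.update q.1 j (z j + q.2)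
    have hψ : Continuous ψ := continuous_fst.update j (by fun_prop)
    have hψ0 : ψ (z, 0) = z := by simp [ψ]
    have hN : V ∩ g ⁻¹' U ∈ 𝓝 z := by
      have hgz : ContinuousAt g z := hgc.continuousAt (hV.mem_nhds hzV.1)
      exact inter_mem (hV.mem_nhds hzV.1) (hgz.preimage_mem_nhds (by rwa [hzV.2]))
    have hN' : ψ ⁻¹' (V ∩ g ⁻¹' U) ∈ 𝓝 (z, (0 : ℝ)) :=
      hψ.continuousAt.preimage_mem_nhds (by rwa [hψ0])
    obtain ⟨A, hA, B, hB, hAB⟩ := mem_nhds_prod_iff.1 hN'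
    obtain ⟨δ, hδ, -, hδB⟩ := exists_pos_Icc_subset hB one_pos
    have hmem : ∀ x ∈ A, ∀ t ∈ Icc (-δ) δ, ψ (x, t) ∈ V ∧ g (ψ (x, t)) ∈ U :=
      fun x hx t ht => hAB ⟨hx, hδB ht⟩
    have hzA := mem_of_mem_nhds hA
    have hcφ : ∀ x ∈ A, ContinuousOn (fun t => g (ψ (x, t)) i) (Icc (-δ) δ) := by
      intro x hx
      refine (continuous_apply i).comp_continuousOn (hgc.comp ?_ fun t ht => (hmem x hx t ht).1)
      exact (hψ.comp (by fun_prop)).continuousOn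
    have hag : ∀ x ∈ A, ∀ t ∈ Icc (-δ) δ, Agree (S.erase j) (g (ψ (x, t))) x := by
      intro x hx t ht c hc
      have := (hg _ (hmem x hx t ht).1).2 c (Finset.mem_of_mem_erase hc)
      simpa [ψ, Function.update_of_ne (Finset.ne_of_mem_erase hc)] using this
    have hinj : InjOn (fun t => g (ψ (z, t)) i) (Icc (-δ) δ) := by
      refine injOn_segment (S := S) (j := j) (p := z) hs fun t ht => ?_
      refine ⟨(hg _ (hmem z hzA t ht).1).1, ?_, hag z hzA t ht⟩
      simpa [ψ] using (hg _ (hmem z hzA t ht).1).2 j hj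
    have hcx : ∀ t ∈ Icc (-δ) δ, ContinuousAt (fun x => g (ψ (x, t)) i) z := by
      intro t ht
      have h1 : ContinuousAt g (ψ (z, t)) :=
        hgc.continuousAt (hV.mem_nhds (hmem z hzA t ht).1)
      have h2 : ContinuousAt (fun x => ψ (x, t)) z := (hψ.comp (by fun_prop)).continuousAt
      exact (continuous_apply i).continuousAt.comp (ContinuousAt.comp (f := fun x => ψ (x, t)) h1 h2)
    have hci : ContinuousAt (fun x : γ → ℝ => x i) z := (continuous_apply i).continuousAt
    have hend : δ ∈ Icc (-δ) δ := ⟨by linarith, le_rfl⟩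
    have hend' : -δ ∈ Icc (-δ) δ := ⟨le_rfl, by linarith⟩
    have hval : g (ψ (z, 0)) i = z i := by rw [hψ0, hzV.2]
    have hfin : ∀ x ∈ A, (∃ t ∈ Icc (-δ) δ, g (ψ (x, t)) i = x i) →
        ∃ w ∈ F ∩ U, Agree (insert i (S.erase j)) w x := by
      rintro x hx ⟨t, ht, he⟩
      refine ⟨g (ψ (x, t)), ⟨(hg _ (hmem x hx t ht).1).1, (hmem x hx t ht).2⟩, fun c hc => ?_⟩
      rcases Finset.mem_insert.1 hc with rfl | hc
      · exact he
      · exact hag x hx t ht c hc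
    rcases straddle_of_injOn hδ (hcφ z hzA) hinj with hst | hst
    · obtain ⟨h1, h2⟩ := hst δ hδ le_rfl
      rw [hval] at h1 h2
      filter_upwards [hA, (hcx _ hend').eventually_lt hci h1, hci.eventually_lt (hcx _ hend) h2]
        with x hx hx1 hx2
      obtain ⟨t, ht, he⟩ := intermediate_value_Icc (by linarith) (hcφ x hx) ⟨hx1.le, hx2.le⟩
      exact hfin x hx ⟨t, ht, he⟩
    · obtain ⟨h1, h2⟩ := hst δ hδ le_rfl
      rw [hval] at h1 h2
      filter_upwards [hA, (hcx _ hend).eventually_lt hci h1, hci.eventually_lt (hcx _ hend') h2]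
        with x hx hx1 hx2
      obtain ⟨t, ht, he⟩ := intermediate_value_Icc' (by linarith) (hcφ x hx) ⟨hx1.le, hx2.le⟩
      exact hfin x hx ⟨t, ht, he⟩
  connected := by
    intro J σ c hJ
    set C : Set (γ → ℝ) := {x | ∀ k ∈ J.erase i, (σ k).Compares (x k) (c k)} with hC
    have hJ' : J.erase i ⊆ S.erase j := by
      intro k hk
      rcases Finset.mem_insert.1 (hJ (Finset.mem_of_mem_erase hk)) with hki | hki
      · exact absurd hki (Finset.ne_of_mem_erase hk)
      · exact hki
    have hZ : IsPreconnected (F ∩ C) :=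
      h.connected _ σ c (hJ'.trans (Finset.erase_subset _ _))
    by_cases hi : i ∈ J
    · have hset : F ∩ {x | ∀ k ∈ J, (σ k).Compares (x k) (c k)} =
          (F ∩ C) ∩ (fun x : γ → ℝ => x i) ⁻¹' {t | (σ i).Compares t (c i)} := by
        ext x
        constructor
        · rintro ⟨h1, h2⟩
          exact ⟨⟨h1, fun k hk => h2 k (Finset.mem_of_mem_erase hk)⟩, h2 i hi⟩
        · rintro ⟨⟨h1, h2⟩, h3⟩
          refine ⟨h1, fun k hk => ?_⟩
          by_cases hki : k = i
          · subst hki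
            exact h3
          · exact h2 k (Finset.mem_erase.2 ⟨hki, hk⟩)
      have hfib : ∀ b, IsPreconnected ((F ∩ C) ∩ {x | x i = b}) := by
        intro b
        have he : (F ∩ C) ∩ {x | x i = b} = MonotoneMaps.level F i b ∩ C := by
          ext x
          constructor
          · rintro ⟨⟨h1, h2⟩, h3⟩
            exact ⟨⟨h1, h3⟩, h2⟩
          · rintro ⟨⟨h1, h3⟩, h2⟩
            exact ⟨⟨h1, h2⟩, h3⟩
        rw [he]
        rcases (MonotoneMaps.level F i b).eq_empty_or_nonempty with h0 | h0
        · rw [h0, empty_inter]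
          exact isPreconnected_empty
        · exact (hl b h0).connected _ σ c hJ'
      have hopen : ∀ z ∈ F ∩ C, ∀ U ∈ 𝓝 z,
          (fun x : γ → ℝ => x i) '' ((F ∩ C) ∩ U) ∈ 𝓝 (z i) := by
        intro z hz U hU
        refine mem_of_superset (h.image_mem_nhds hj hs hz.1 hU) (image_mono ?_)
        rintro x ⟨h1, h2, h3⟩
        refine ⟨⟨h1, fun k hk => ?_⟩, h3⟩
        rw [h2 k (hJ' hk)]
        exact hz.2 k hk
      rw [hset]
      cases hσ : σ i with
      | lt => exact isPreconnected_inter_preimage hZ (continuous_apply i) hfib hopen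
                (T := Iio (c i)) isOpen_Iio ordConnected_Iio
      | eq => exact hfib (c i)
      | gt => exact isPreconnected_inter_preimage hZ (continuous_apply i) hfib hopen
                (T := Ioi (c i)) isOpen_Ioi ordConnected_Ioi
    · rwa [hC, Finset.erase_eq_of_notMem hi] at hZ

/-- `F` is the graph of a monotone map of `n` variables, the coordinates in `S`. -/
def IsMonotoneChart : ℕ → Finset γ → Set (γ → ℝ) → Prop
  | 0, S, F => S.card = 0 ∧ IsChart S F
  | n + 1, S, F => S.card = n + 1 ∧ IsChart S F ∧ ∀ i ∉ S, ∀ j ∈ S, DependsOn S F i j →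
      (∀ b, (level F i b).Nonempty → IsMonotoneChart n (S.erase j) (level F i b)) ∧
      ∀ H : Finset γ, i ∉ H → H.card = n → ∀ b b', (level F i b).Nonempty →
        Separates H (level F i b) → Separates H (level F i b')

namespace IsMonotoneChart

lemma card_eq {n : ℕ} (h : IsMonotoneChart n S F) : S.card = n := by
  cases n with
  | zero => exact h.1
  | succ n => exact h.1

lemma isChart {n : ℕ} (h : IsMonotoneChart n S F) : IsChart S F := by
  cases n with
  | zero => exact h.2
  | succ n => exact h.2.1

lemma separates_exchange {n : ℕ} (h : IsMonotoneChart n S F) {i j : γ} (hi : i ∉ S) (hj : j ∈ S)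
    (hd : DependsOn S F i j) : Separates (insert i (S.erase j)) F := by
  cases n with
  | zero => simp [Finset.card_eq_zero.1 h.1] at hj
  | succ n =>
    intro z hz w hw ha
    have hi' : z i = w i := ha i (Finset.mem_insert_self _ _)
    exact ((h.2.2 i hi j hj hd).1 (w i) ⟨w, hw, rfl⟩).isChart.separates z ⟨hz, hi'⟩ w ⟨hw, rfl⟩
      (ha.mono (Finset.subset_insert _ _))

lemma isChart_exchange {n : ℕ} (h : IsMonotoneChart n S F) {i j : γ} (hi : i ∉ S) (hj : j ∈ S)
    (hd : DependsOn S F i j) : IsChart (insert i (S.erase j)) F := by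
  refine h.isChart.exchange hj (h.separates_exchange hi hj hd) fun b hb => ?_
  cases n with
  | zero => simp [Finset.card_eq_zero.1 h.1] at hj
  | succ n => exact ((h.2.2 i hi j hj hd).1 b hb).isChart

end IsMonotoneChart

lemma Separates.erase_level {i : γ} (h : Separates H F) (b : ℝ) :
    Separates (H.erase i) (level F i b) := by
  intro z hz w hw ha
  refine h z hz.1 w hw.1 fun c hc => ?_
  by_cases hci : c = i
  · subst hci
    exact hz.2.trans hw.2.symm
  · exact ha c (Finset.mem_erase.2 ⟨hci, hc⟩)

lemma IsMonotoneChart.le_card {n : ℕ} (h : IsMonotoneChart n S F) (hH : Separates H F) :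
    n ≤ H.card := by
  induction n generalizing S F H with
  | zero => exact Nat.zero_le _
  | succ n ih =>
    by_cases hex : ∃ i ∈ H, i ∉ S ∧ ∃ j ∈ S, DependsOn S F i j
    · obtain ⟨i, hiH, hiS, j, hj, hd⟩ := hex
      obtain ⟨p, hp⟩ := h.isChart.nonempty
      have := ih ((h.2.2 i hiS j hj hd).1 (p i) ⟨p, hp, rfl⟩) (hH.erase_level (p i))
      rw [Finset.card_erase_of_mem hiH] at this
      have := Finset.card_pos.2 ⟨i, hiH⟩
      omega
    · push Not at hex
      rw [← h.card_eq]
      refine Finset.card_le_card fun j hj => ?_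
      by_contra hjH
      obtain ⟨p, hp⟩ := h.isChart.nonempty
      obtain ⟨q, hq, hne, ha⟩ := h.isChart.exists_ne hj hp
      refine hne (hH q hq p hp fun c hc => ?_)
      by_cases hcS : c ∈ S
      · exact ha c (Finset.mem_erase.2 ⟨fun he => hjH (he ▸ hc), hcS⟩)
      · refine h.isChart.eq_of_not_dependsOn (T := S) (fun k hk => hex c hc hcS k hk) hq hp ?_
        simp [Agree]

/-- The coordinate that is exchanged for `j` depends on `l` if `j` becomes dependent on `l`. -/
lemma IsMonotoneChart.dependsOn_of_exchange {n : ℕ} (h : IsMonotoneChart n S F) {i j l : γ}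
    (hi : i ∉ S) (hj : j ∈ S) (hd : DependsOn S F i j) {z w : γ → ℝ} (hz : z ∈ F) (hw : w ∈ F)
    (ha : Agree ((S.erase j).erase l) z w) (hzi : z i = w i) (hzj : z j ≠ w j) :
    DependsOn S F i l := by
  by_contra hn
  refine hzj (h.isChart.eq_of_eq_of_plane (l := l) (u := j) (v := i) (p := w) hj
    (h.isChart.separates_self hj) (h.separates_exchange hi hj hd) ?_ hz hw ha (fun _ _ => rfl) hzi)
  intro a haF b hbF haw hbw hab
  by_contra hne
  refine hn ⟨a, haF, b, hbF, fun c hc => ?_, hne⟩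
  by_cases hcj : c = j
  · subst hcj
    exact hab
  · rw [Finset.erase_right_comm] at haw hbw
    exact (haw.trans hbw.symm) c (Finset.mem_erase.2 ⟨hcj, hc⟩)

/-- The exchange property of basis sets. -/
lemma IsMonotoneChart.exists_dependsOn {n : ℕ} (h : IsMonotoneChart n S F) (hH : Separates H F)
    (hc : H.card = n) {i : γ} (hiH : i ∈ H) (hiS : i ∉ S) :
    ∃ l ∈ S, l ∉ H ∧ DependsOn S F i l := by
  induction n generalizing S F H i with
  | zero => simp [Finset.card_eq_zero.1 hc] at hiH
  | succ n ih =>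
    obtain ⟨j, hj, hd⟩ : ∃ j ∈ S, DependsOn S F i j := by
      by_contra hno
      push Not at hno
      have hs : Separates (H.erase i) F := by
        intro z hz w hw ha
        refine hH z hz w hw fun c hc => ?_
        by_cases hci : c = i
        · subst hci
          exact h.isChart.eq_of_not_dependsOn (T := S) hno hz hw (by simp [Agree])
        · exact ha c (Finset.mem_erase.2 ⟨hci, hc⟩)
      have := h.le_card hs
      rw [Finset.card_erase_of_mem hiH] at this
      omega
    by_cases hjH : j ∈ H
    · obtain ⟨p, hp⟩ := h.isChart.nonempty
      have hji : j ≠ i := fun he => hiS (he ▸ hj)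
      obtain ⟨l, hl, hlH, z, hz, w, hw, ha, hne⟩ :=
        ih ((h.2.2 i hiS j hj hd).1 (p i) ⟨p, hp, rfl⟩) (hH.erase_level (p i))
          (by rw [Finset.card_erase_of_mem hiH]; omega) (i := j)
          (Finset.mem_erase.2 ⟨hji, hjH⟩) (Finset.notMem_erase _ _)
      have hlS := Finset.mem_of_mem_erase hl
      refine ⟨l, hlS, fun hm => hlH (Finset.mem_erase.2 ⟨fun he => hiS (he ▸ hlS), hm⟩), ?_⟩
      exact h.dependsOn_of_exchange hiS hj hd hz.1 hw.1 ha (hz.2.trans hw.2.symm) hne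
    · exact ⟨j, hj, hjH, hd⟩

lemma Separates.level_of_insert {j : γ} (h : Separates (insert j H) F) (b : ℝ) :
    Separates H (level F j b) := by
  intro z hz w hw ha
  refine h z hz.1 w hw.1 fun c hc => ?_
  rcases Finset.mem_insert.1 hc with rfl | hc
  · exact hz.2.trans hw.2.symm
  · exact ha c hc

lemma DependsOn.of_level {i j l : γ} {b : ℝ} (hd : DependsOn (S.erase j) (level F j b) i l) :
    i ≠ j ∧ DependsOn S F i l := by
  obtain ⟨z, hz, w, hw, ha, hne⟩ := hd
  refine ⟨fun he => hne (by rw [he, hz.2, hw.2]), z, hz.1, w, hw.1, fun c hc => ?_, hne⟩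
  by_cases hcj : c = j
  · subst hcj
    exact hz.2.trans hw.2.symm
  · rw [Finset.erase_right_comm] at ha
    exact ha c (Finset.mem_erase.2 ⟨hcj, hc⟩)

/-- The restriction of a monotone map to a coordinate hyperplane `x_j = b` is monotone, and its
basis sets are those of the contraction of the matroid by `j`. -/
lemma IsMonotoneChart.level_and_separates {n : ℕ} (h : IsMonotoneChart (n + 1) S F) {j : γ}
    (hj : j ∈ S) {b : ℝ} (hne : (level F j b).Nonempty) :
    IsMonotoneChart n (S.erase j) (level F j b) ∧
      ∀ H : Finset γ, H.card = n → Separates H (level F j b) → Separates (insert j H) F := by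
  induction n generalizing S F j b with
  | zero =>
    have hS : S.erase j = ∅ := by
      rw [← Finset.card_eq_zero, Finset.card_erase_of_mem hj, h.card_eq]
    refine ⟨⟨by simp [hS], h.isChart.level hj hne⟩, fun H hH _ => ?_⟩
    rw [Finset.card_eq_zero.1 hH, ← hS]
    exact h.isChart.separates_self hj
  | succ n ih =>
    have hcard : (S.erase j).card = n + 1 := by
      rw [Finset.card_erase_of_mem hj, h.card_eq]
      omega
    have hmono : IsMonotoneChart (n + 1) (S.erase j) (level F j b) := by
      refine ⟨hcard, h.isChart.level hj hne, fun i hi l hl hd => ?_⟩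
      obtain ⟨hij, hd'⟩ := hd.of_level
      have hiS : i ∉ S := fun hm => hi (Finset.mem_erase.2 ⟨hij, hm⟩)
      obtain ⟨h1, h2⟩ := h.2.2 i hiS l (Finset.mem_of_mem_erase hl) hd'
      have hjl : j ∈ S.erase l := Finset.mem_erase.2 ⟨(Finset.ne_of_mem_erase hl).symm, hj⟩
      have key : ∀ c, (level (level F j b) i c).Nonempty →
          IsMonotoneChart n ((S.erase j).erase l) (level (level F j b) i c) ∧
          ∀ H : Finset γ, H.card = n → Separates H (level (level F j b) i c) →
            Separates (insert j H) (level F i c) := by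
        intro c hc
        rw [level_comm] at hc ⊢
        rw [Finset.erase_right_comm]
        exact ih (h1 c (hc.mono (level_subset _ _ _))) hjl hc
      refine ⟨fun c hc => (key c hc).1, fun H hiH hH c c' hc hs => ?_⟩
      have hjH : j ∉ H := by
        intro hjH
        have hs' : Separates (H.erase j) (level (level F j b) i c) := by
          have := hs.erase_level (i := j) b
          refine this.subset fun z hz => ⟨hz, hz.1.2⟩
        have := (key c hc).1.le_card hs'
        rw [Finset.card_erase_of_mem hjH] at this
        have := Finset.card_pos.2 ⟨j, hjH⟩
        omega
      have := h2 (insert j H) (by simp [hij, hiH]) (by rw [Finset.card_insert_of_notMem hjH, hH])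
        c c' (hc.mono fun z hz => ⟨hz.1.1, hz.2⟩) ((key c hc).2 H hH hs)
      rw [level_comm]
      exact this.level_of_insert b
    refine ⟨hmono, fun H hH hs => ?_⟩
    by_cases hsub : H ⊆ S.erase j
    · rw [Finset.eq_of_subset_of_card_le hsub (by omega)]
      exact h.isChart.separates_self hj
    · obtain ⟨i, hiH, hi⟩ := Finset.not_subset.1 hsub
      obtain ⟨l, hl, hlH, hd⟩ := hmono.exists_dependsOn hs hH hiH hi
      obtain ⟨hij, hd'⟩ := hd.of_level
      have hiS : i ∉ S := fun hm => hi (Finset.mem_erase.2 ⟨hij, hm⟩)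
      obtain ⟨h1, h2⟩ := h.2.2 i hiS l (Finset.mem_of_mem_erase hl) hd'
      have hjl : j ∈ S.erase l := Finset.mem_erase.2 ⟨(Finset.ne_of_mem_erase hl).symm, hj⟩
      obtain ⟨p, hp⟩ := hne
      have hp' : (level (level F i (p i)) j b).Nonempty := ⟨p, ⟨hp.1, rfl⟩, hp.2⟩
      have hHi : (H.erase i).card = n := by
        rw [Finset.card_erase_of_mem hiH, hH]
        omega
      have hsi : Separates (H.erase i) (level (level F i (p i)) j b) := by
        rw [level_comm]
        exact hs.erase_level _
      have hb := (ih (h1 (p i) ⟨p, hp.1, rfl⟩) hjl hp').2 _ hHi hsi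
      intro z hz w hw ha
      have hjH : j ∉ H.erase i := by
        intro hjH
        have hs' := (ih (h1 (p i) ⟨p, hp.1, rfl⟩) hjl hp').1.le_card
          ((hsi.erase_level (i := j) b).subset fun z hz => ⟨hz, hz.2⟩)
        rw [Finset.card_erase_of_mem hjH] at hs'
        have := Finset.card_pos.2 ⟨j, hjH⟩
        omega
      have hb' := h2 (insert j (H.erase i)) (by simp [hij])
        (by rw [Finset.card_insert_of_notMem hjH, hHi]) (p i) (w i) ⟨p, hp.1, rfl⟩ hb
      refine hb' z ⟨hz, ha i (Finset.mem_insert_of_mem hiH)⟩ w ⟨hw, rfl⟩ (ha.mono ?_)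
      exact Finset.insert_subset_insert _ (Finset.erase_subset _ _)

/-- The exchange of one coordinate. -/
lemma IsMonotoneChart.exchange {n : ℕ} (h : IsMonotoneChart n S F) {i j : γ}
    (hi : i ∉ S) (hj : j ∈ S) (hd : DependsOn S F i j) :
    IsMonotoneChart n (insert i (S.erase j)) F := by
  induction n generalizing S F i j with
  | zero => simp [Finset.card_eq_zero.1 h.1] at hj
  | succ n ih =>
    have hij : i ≠ j := fun he => hi (he ▸ hj)
    have hi' : i ∉ S.erase j := fun hm => hi (Finset.mem_of_mem_erase hm)
    refine ⟨?_, h.isChart_exchange hi hj hd, fun c hc d hdS hcd => ?_⟩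
    · rw [Finset.card_insert_of_notMem hi', Finset.card_erase_of_mem hj, h.card_eq]
      omega
    have hci : c ≠ i := fun he => hc (he ▸ Finset.mem_insert_self _ _)
    have hdom : ∀ d ∈ S.erase j,
        (insert i (S.erase j)).erase d = insert i ((S.erase j).erase d) := by
      intro d hd
      exact Finset.erase_insert_of_ne fun he => hi' (he ▸ hd)
    have hconst : ∀ H : Finset γ, c = j → H.card = n → ∀ b b', (level F c b).Nonempty →
        Separates H (level F c b) → Separates H (level F c b') := by
      rintro H rfl hH b b' hb hs
      exact ((h.level_and_separates hj hb).2 H hH hs).level_of_insert b'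
    obtain ⟨z, hz, w, hw, ha, hne⟩ := hcd
    by_cases hdi : d = i
    · subst hdi
      rw [Finset.erase_insert hi'] at ha ⊢
      by_cases hcj : c = j
      · refine ⟨fun b hb => ?_, fun H _ hH => hconst H hcj hH⟩
        subst hcj
        exact (h.level_and_separates hj hb).1
      · have hcS : c ∉ S := fun hm =>
          hc (Finset.mem_insert_of_mem (Finset.mem_erase.2 ⟨hcj, hm⟩))
        exact h.2.2 c hcS j hj ⟨z, hz, w, hw, ha, hne⟩
    · have hdS' : d ∈ S.erase j := (Finset.mem_insert.1 hdS).resolve_left hdi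
      have hdj := Finset.ne_of_mem_erase hdS'
      have hdS'' := Finset.mem_of_mem_erase hdS'
      rw [hdom d hdS'] at ha ⊢
      have hai : z i = w i := ha i (Finset.mem_insert_self _ _)
      have ha' : Agree ((S.erase j).erase d) z w := ha.mono (Finset.subset_insert _ _)
      by_cases hcj : c = j
      · refine ⟨fun b hb => ?_, fun H _ hH => hconst H hcj hH⟩
        subst hcj
        have hid := h.dependsOn_of_exchange hi hj hd hz hw ha' hai hne
        have hsep := h.separates_exchange hi hdS'' hid
        have hlev := (h.level_and_separates hj hb).1
        refine ih hlev hi' hdS' (hlev.isChart.dependsOn_of_separates hdS' ?_)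
        refine Separates.level_of_insert (j := c) ?_ b
        rw [Finset.insert_comm, Finset.erase_right_comm, Finset.insert_erase
          (Finset.mem_erase.2 ⟨hdj.symm, hj⟩)]
        exact hsep
      · have hcS : c ∉ S := fun hm =>
          hc (Finset.mem_insert_of_mem (Finset.mem_erase.2 ⟨hcj, hm⟩))
        by_cases hcdj : DependsOn S F c j
        · obtain ⟨h1, h2⟩ := h.2.2 c hcS j hj hcdj
          refine ⟨fun b hb => ?_, h2⟩
          obtain ⟨b₀, hb₀, hdep⟩ : ∃ b₀, (level F c b₀).Nonempty ∧
              DependsOn (S.erase j) (level F c b₀) i d := by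
            by_contra hno
            push Not at hno
            refine hne (h.isChart.eq_of_eq_of_plane (l := d) (u := c) (v := i) (p := w) hj
              (h.separates_exchange hcS hj hcdj) (h.separates_exchange hi hj hd) ?_ hz hw ha'
              (fun _ _ => rfl) hai)
            intro x hx y hy hxw hyw hxy
            by_contra hxyi
            exact hno (y c) ⟨y, hy, rfl⟩
              ⟨x, ⟨hx, hxy⟩, y, ⟨hy, rfl⟩, hxw.trans hyw.symm, hxyi⟩
          refine ih (h1 b hb) hi' hdS' ((h1 b hb).isChart.dependsOn_of_separates hdS' ?_)
          refine h2 _ ?_ ?_ b₀ b hb₀ ((h1 b₀ hb₀).separates_exchange hi' hdS' hdep)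
          · simp [hci, hcS]
          · have hi'' : i ∉ (S.erase j).erase d := fun hm => hi' (Finset.mem_of_mem_erase hm)
            rw [Finset.card_insert_of_notMem hi'', Finset.card_erase_of_mem hdS',
              Finset.card_erase_of_mem hj, h.card_eq]
            have := Finset.card_pos.2 ⟨d, hdS'⟩
            rw [Finset.card_erase_of_mem hj, h.card_eq] at this
            omega
        · have hcdd : DependsOn S F c d := by
            by_contra hno
            refine hne (h.isChart.eq_of_not_dependsOn (T := {j, d}) ?_ hz hw ?_)
            · intro k hk
              rcases Finset.mem_insert.1 hk with rfl | hk
              · exact hcdj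
              · rw [Finset.mem_singleton.1 hk]
                exact hno
            · refine ha'.mono fun k hk => ?_
              simp only [Finset.mem_sdiff, Finset.mem_insert, Finset.mem_singleton, not_or] at hk
              simp [hk.1, hk.2.1, hk.2.2]
          obtain ⟨h1, h2⟩ := h.2.2 c hcS d hdS'' hcdd
          refine ⟨fun b hb => ?_, h2⟩
          rw [Finset.erase_right_comm]
          have hjd : j ∈ S.erase d := Finset.mem_erase.2 ⟨hdj.symm, hj⟩
          refine ih (h1 b hb) (fun hm => hi (Finset.mem_of_mem_erase hm)) hjd ?_
          obtain ⟨p, hp⟩ := hb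
          obtain ⟨q, hq, hqp, hag⟩ := h.isChart.exists_ne hj hp.1
          have hqc : q c = p c := by
            by_contra hqc
            exact hcdj ⟨q, hq, p, hp.1, hag, hqc⟩
          refine ⟨q, ⟨hq, hqc.trans hp.2⟩, p, hp, ?_, fun he => hqp ?_⟩
          · rw [Finset.erase_right_comm]
            exact hag.mono (Finset.erase_subset _ _)
          · refine h.separates_exchange hi hj hd q hq p hp.1 fun k hk => ?_
            rcases Finset.mem_insert.1 hk with rfl | hk
            · exact he
            · exact hag k hk

/-- A monotone map is a monotone map over each of its basis sets. -/
theorem IsMonotoneChart.of_separates {n : ℕ} (h : IsMonotoneChart n S F) (hH : Separates H F)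
    (hc : H.card = n) : IsMonotoneChart n H F := by
  induction hm : (H \ S).card generalizing S with
  | zero =>
    have hsub : H ⊆ S := by
      rwa [Finset.card_eq_zero, Finset.sdiff_eq_empty_iff_subset] at hm
    rwa [Finset.eq_of_subset_of_card_le hsub (by rw [hc, h.card_eq])]
  | succ m ih =>
    obtain ⟨i, hi⟩ := Finset.card_pos.1 (by omega : 0 < (H \ S).card)
    obtain ⟨hiH, hiS⟩ := Finset.mem_sdiff.1 hi
    obtain ⟨l, hl, hlH, hd⟩ := h.exists_dependsOn hH hc hiH hiS
    refine ih (h.exchange hiS hl hd) ?_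
    have : H \ insert i (S.erase l) = (H \ S).erase i := by
      ext k
      simp only [Finset.mem_sdiff, Finset.mem_insert, Finset.mem_erase, not_or, not_and, ne_eq]
      constructor
      · rintro ⟨h1, h2, h3⟩
        exact ⟨h2, h1, h3 fun he => hlH (he ▸ h1)⟩
      · rintro ⟨h1, h2, h3⟩
        exact ⟨h2, h1, fun _ => h3⟩
    rw [this, Finset.card_erase_of_mem hi]
    omega

end Monotone

section Realization

variable {α β γ : Type} {e : α ⊕ β → γ} {S : Finset γ} {F : Set (γ → ℝ)}
  {X : Set (α → ℝ)} {f : (α → ℝ) → (β → ℝ)}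

/-- `F` is the graph of `f : X → ℝ^β`, the coordinates being renamed by `e`; the coordinates
outside the range of `e` are constant on `F`. -/
structure Realizes (e : α ⊕ β → γ) (S : Finset γ) (F : Set (γ → ℝ)) (X : Set (α → ℝ))
    (f : (α → ℝ) → (β → ℝ)) : Prop where
  injective : Function.Injective e
  mem_iff : ∀ c, c ∈ S ↔ ∃ a, e (Sum.inl a) = c
  image_eq : (fun z => z ∘ e) '' F = graph X f
  constant : ∀ c, c ∉ range e → ∀ z ∈ F, ∀ w ∈ F, z c = w c

/-- The `x`-coordinates of a point. -/
def fstPart (e : α ⊕ β → γ) (z : γ → ℝ) : α → ℝ := fun a => z (e (Sum.inl a))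

/-- The `y`-coordinates of a point. -/
def sndPart (e : α ⊕ β → γ) (z : γ → ℝ) : β → ℝ := fun b => z (e (Sum.inr b))

lemma continuous_fstPart : Continuous (fstPart e) := continuous_pi fun _ => continuous_apply _

lemma continuous_sndPart : Continuous (sndPart e) := continuous_pi fun _ => continuous_apply _

namespace Realizes

lemma fst_mem (R : Realizes e S F X f) {z : γ → ℝ} (hz : z ∈ F) : fstPart e z ∈ X := by
  have : z ∘ e ∈ graph X f := R.image_eq ▸ ⟨z, hz, rfl⟩
  exact this.1

lemma snd_eq (R : Realizes e S F X f) {z : γ → ℝ} (hz : z ∈ F) :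
    sndPart e z = f (fstPart e z) := by
  have : z ∘ e ∈ graph X f := R.image_eq ▸ ⟨z, hz, rfl⟩
  exact this.2

lemma exists_mem (R : Realizes e S F X f) {x : α → ℝ} (hx : x ∈ X) :
    ∃ z ∈ F, fstPart e z = x := by
  have : (Sum.elim x (f x) : α ⊕ β → ℝ) ∈ graph X f := ⟨hx, rfl⟩
  rw [← R.image_eq] at this
  obtain ⟨z, hz, h⟩ := this
  exact ⟨z, hz, funext fun a => congrFun h (Sum.inl a)⟩

lemma image_fst (R : Realizes e S F X f) : fstPart e '' F = X := by
  ext x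
  constructor
  · rintro ⟨z, hz, rfl⟩
    exact R.fst_mem hz
  · exact fun hx => R.exists_mem hx

lemma agree_iff (R : Realizes e S F X f) {z w : γ → ℝ} :
    Agree S z w ↔ fstPart e z = fstPart e w := by
  constructor
  · exact fun h => funext fun a => h _ ((R.mem_iff _).2 ⟨a, rfl⟩)
  · intro h c hc
    obtain ⟨a, rfl⟩ := (R.mem_iff c).1 hc
    exact congrFun h a

lemma ext (R : Realizes e S F X f) {z w : γ → ℝ} (hz : z ∈ F) (hw : w ∈ F)
    (h : fstPart e z = fstPart e w) : z = w := by
  funext c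
  by_cases hc : c ∈ range e
  · obtain ⟨a | b, rfl⟩ := hc
    · exact congrFun h a
    · have : sndPart e z = sndPart e w := by rw [R.snd_eq hz, R.snd_eq hw, h]
      exact congrFun this b
  · exact R.constant c hc z hz w hw

lemma separates (R : Realizes e S F X f) : Separates S F :=
  fun _ hz _ hw ha => R.ext hz hw (R.agree_iff.1 ha)

lemma nonempty_iff (R : Realizes e S F X f) : F.Nonempty ↔ X.Nonempty := by
  rw [← R.image_fst, image_nonempty]

lemma inr_notMem (R : Realizes e S F X f) (i : β) : e (Sum.inr i) ∉ S := by
  intro h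
  obtain ⟨a, ha⟩ := (R.mem_iff _).1 h
  cases R.injective ha

lemma inl_mem (R : Realizes e S F X f) (j : α) : e (Sum.inl j) ∈ S := (R.mem_iff _).2 ⟨j, rfl⟩

lemma card_eq (R : Realizes e S F X f) : S.card = Nat.card α := by
  rw [← Nat.card_eq_finsetCard S]
  refine (Nat.card_congr (Equiv.ofBijective
    (fun a : α => (⟨e (Sum.inl a), R.inl_mem a⟩ : S)) ⟨?_, ?_⟩)).symm
  · intro a b h
    have := R.injective (congrArg Subtype.val h)
    exact Sum.inl_injective this
  · rintro ⟨c, hc⟩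
    obtain ⟨a, rfl⟩ := (R.mem_iff c).1 hc
    exact ⟨a, rfl⟩

lemma agree_erase_iff [DecidableEq γ] (R : Realizes e S F X f) {j : α} {z w : γ → ℝ} :
    Agree (S.erase (e (Sum.inl j))) z w ↔ AgreeOff j (fstPart e z) (fstPart e w) := by
  constructor
  · intro h a ha
    refine h _ (Finset.mem_erase.2 ⟨fun he => ha (Sum.inl_injective (R.injective he)), ?_⟩)
    exact R.inl_mem a
  · intro h c hc
    obtain ⟨a, rfl⟩ := (R.mem_iff c).1 (Finset.mem_of_mem_erase hc)
    exact h a fun he => Finset.ne_of_mem_erase hc (he ▸ rfl)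

lemma dependsOn_iff [DecidableEq γ] (R : Realizes e S F X f) {i : β} {j : α} :
    DependsOn S F (e (Sum.inr i)) (e (Sum.inl j)) ↔ ¬ IndependentOf X (fun x => f x i) j := by
  have hval : ∀ z ∈ F, z (e (Sum.inr i)) = f (fstPart e z) i := fun z hz =>
    congrFun (R.snd_eq hz) i
  constructor
  · rintro ⟨z, hz, w, hw, ha, hne⟩ hind
    rw [hval z hz, hval w hw] at hne
    exact hne (hind _ (R.fst_mem hz) _ (R.fst_mem hw) (R.agree_erase_iff.1 ha))
  · intro hind
    simp only [IndependentOf, not_forall] at hind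
    obtain ⟨x, hx, y, hy, ha, hne⟩ := hind
    obtain ⟨z, hz, rfl⟩ := R.exists_mem hx
    obtain ⟨w, hw, rfl⟩ := R.exists_mem hy
    exact ⟨z, hz, w, hw, R.agree_erase_iff.2 ha, by rwa [hval z hz, hval w hw]⟩

lemma exists_lift (R : Realizes e S F X f) (hf : ContinuousOn f X) (hX : X.Nonempty) :
    ∃ g : (α → ℝ) → (γ → ℝ), ContinuousOn g X ∧ ∀ x ∈ X, g x ∈ F ∧ fstPart e (g x) = x := by
  obtain ⟨z₀, hz₀⟩ := R.nonempty_iff.2 hX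
  refine ⟨fun x => Function.extend e (Sum.elim x (f x)) z₀, ?_, fun x hx => ?_⟩
  · rw [continuousOn_pi]
    intro c
    by_cases hc : c ∈ range e
    · obtain ⟨d, rfl⟩ := hc
      simp only [R.injective.extend_apply]
      cases d with
      | inl a => exact (continuous_apply a).continuousOn
      | inr b => exact (continuous_apply b).comp_continuousOn hf
    · have hc' : ¬ ∃ d, e d = c := hc
      simp only [Function.extend_apply' _ _ _ hc']
      exact continuousOn_const
  · obtain ⟨z, hz, rfl⟩ := R.exists_mem hx
    have : Function.extend e (Sum.elim (fstPart e z) (f (fstPart e z))) z₀ = z := by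
      funext c
      by_cases hc : c ∈ range e
      · obtain ⟨d, rfl⟩ := hc
        rw [R.injective.extend_apply]
        cases d with
        | inl a => rfl
        | inr b => exact (congrFun (R.snd_eq hz) b).symm
      · have hc' : ¬ ∃ d, e d = c := hc
        rw [Function.extend_apply' _ _ _ hc']
        exact R.constant c hc _ hz₀ _ hz
    simpa only [this] using ⟨hz, trivial⟩

lemma isChart (R : Realizes e S F X f) {L : FirstOrder.Language.{u, v}} [L.Structure ℝ]
    (h : IsBoundedContinuousMap L X f) : IsChart S F := by
  obtain ⟨g, hgc, hg⟩ := R.exists_lift h.continuous h.nonempty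
  have hgz : ∀ z ∈ F, g (fstPart e z) = z := fun z hz =>
    R.ext (hg _ (R.fst_mem hz)).1 hz (hg _ (R.fst_mem hz)).2
  refine ⟨R.nonempty_iff.2 h.nonempty, R.separates, fun z hz U hU => ?_, fun J σ c hJ => ?_⟩
  · have hX := h.domain.isOpen.mem_nhds (R.fst_mem hz)
    have h1 : X ∩ g ⁻¹' U ∈ 𝓝 (fstPart e z) :=
      inter_mem hX ((hgc.continuousAt hX).preimage_mem_nhds (by rwa [hgz z hz]))
    filter_upwards [continuous_fstPart.continuousAt.preimage_mem_nhds h1] with x hx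
    exact ⟨g (fstPart e x), ⟨(hg _ hx.1).1, hx.2⟩, R.agree_iff.2 (hg _ hx.1).2⟩
  · have hinj : Function.Injective fun a => e (Sum.inl a) := R.injective.comp Sum.inl_injective
    have hcone := h.domain.connected {x | ∀ a ∈ J.preimage (fun a => e (Sum.inl a)) hinj.injOn,
      (σ (e (Sum.inl a))).Compares (x a) (c (e (Sum.inl a)))} ⟨_, _, _, rfl⟩
    convert hcone.image g (hgc.mono inter_subset_left) using 1
    ext z
    constructor
    · rintro ⟨hz, hzC⟩
      refine ⟨fstPart e z, ⟨R.fst_mem hz, fun a ha => hzC _ ?_⟩, hgz z hz⟩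
      simpa using ha
    · rintro ⟨x, ⟨hx, hxC⟩, rfl⟩
      refine ⟨(hg x hx).1, fun k hk => ?_⟩
      obtain ⟨a, rfl⟩ := (R.mem_iff k).1 (hJ hk)
      have := hxC a (Finset.mem_preimage.2 hk)
      rwa [← congrFun (hg x hx).2 a] at this

lemma isOpen_of_isChart (R : Realizes e S F X f) (h : IsChart S F) {z : γ → ℝ} (hz : z ∈ F)
    {U : Set (γ → ℝ)} (hU : U ∈ 𝓝 z) :
    ∀ᶠ x in 𝓝 (fstPart e z), ∃ w ∈ F ∩ U, fstPart e w = x := by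
  have hinj : Function.Injective fun a => e (Sum.inl a) := R.injective.comp Sum.inl_injective
  have hcont : Continuous fun x : α → ℝ => Function.extend (fun a => e (Sum.inl a)) x z := by
    refine continuous_pi fun c => ?_
    by_cases hc : ∃ a, e (Sum.inl a) = c
    · obtain ⟨a, rfl⟩ := hc
      simpa only [hinj.extend_apply] using continuous_apply a
    · simpa only [Function.extend_apply' _ _ _ hc] using continuous_const
  have h0 : Function.extend (fun a => e (Sum.inl a)) (fstPart e z) z = z := by
    funext c
    by_cases hc : ∃ a, e (Sum.inl a) = c
    · obtain ⟨a, rfl⟩ := hc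
      exact hinj.extend_apply _ _ _
    · exact Function.extend_apply' _ _ _ hc
  have ht := hcont.tendsto (fstPart e z)
  rw [h0] at ht
  filter_upwards [ht.eventually (h.isOpen z hz U hU)] with x hx
  obtain ⟨w, hw, ha⟩ := hx
  refine ⟨w, hw, funext fun a => ?_⟩
  have := ha _ (R.inl_mem a)
  rwa [hinj.extend_apply] at this

end Realizes

lemma isBounded_image_comp {δ ε : Type} {F : Set (δ → ℝ)} (hF : Bornology.IsBounded F)
    (e : ε → δ) : Bornology.IsBounded ((fun z => z ∘ e) '' F) := by
  rw [← Bornology.forall_isBounded_image_eval_iff] at hF ⊢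
  intro c
  rw [image_image]
  exact hF (e c)

lemma Realizes.isBoundedContinuousMap [Finite α] [Finite β] [Finite γ] (R : Realizes e S F X f)
    {L : FirstOrder.Language.{u, v}} [L.Structure ℝ]
    (hdef : (univ : Set ℝ).Definable L F) (hbd : Bornology.IsBounded F) (h : IsChart S F) :
    IsBoundedContinuousMap L X f where
  nonempty := R.nonempty_iff.1 h.nonempty
  domain := by
    have himg : (fun z : γ → ℝ => z ∘ fun a => e (Sum.inl a)) '' F = X := R.image_fst
    refine ⟨?_, ?_, ?_, ?_⟩
    · rw [← himg]
      exact hdef.image_comp _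
    · rw [isOpen_iff_mem_nhds]
      intro x hx
      obtain ⟨z, hz, rfl⟩ := R.exists_mem hx
      filter_upwards [R.isOpen_of_isChart h hz univ_mem] with y hy
      obtain ⟨w, hw, rfl⟩ := hy
      exact R.fst_mem hw.1
    · rw [← himg]
      exact isBounded_image_comp hbd _
    · rintro C ⟨J, σ, c, rfl⟩
      classical
      have hinj : Function.Injective fun a => e (Sum.inl a) := R.injective.comp Sum.inl_injective
      have hconn := h.connected (J.image fun a => e (Sum.inl a))
        (Function.extend (fun a => e (Sum.inl a)) σ fun _ => Ordering.eq)
        (Function.extend (fun a => e (Sum.inl a)) c 0) (by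
          intro k hk
          obtain ⟨a, -, rfl⟩ := Finset.mem_image.1 hk
          exact R.inl_mem a)
      convert hconn.image (fstPart e) continuous_fstPart.continuousOn using 1
      have hiff : ∀ z : γ → ℝ, (∀ k ∈ J.image fun a => e (Sum.inl a),
          (Function.extend (fun a => e (Sum.inl a)) σ (fun _ => Ordering.eq) k).Compares (z k)
            (Function.extend (fun a => e (Sum.inl a)) c 0 k)) ↔
          ∀ a ∈ J, (σ a).Compares (fstPart e z a) (c a) := by
        intro z
        rw [Finset.forall_mem_image]
        simp only [hinj.extend_apply]
        rfl
      ext x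
      constructor
      · rintro ⟨hx, hxC⟩
        obtain ⟨z, hz, rfl⟩ := R.exists_mem hx
        exact ⟨z, ⟨hz, (hiff z).2 hxC⟩, rfl⟩
      · rintro ⟨z, ⟨hz, hzC⟩, rfl⟩
        exact ⟨R.fst_mem hz, (hiff z).1 hzC⟩
  definable := by
    rw [← R.image_eq]
    exact hdef.image_comp e
  continuous := by
    intro x hx
    obtain ⟨z, hz, rfl⟩ := R.exists_mem hx
    refine ContinuousAt.continuousWithinAt ?_
    intro W hW
    rw [← R.snd_eq hz] at hW
    rw [mem_map]
    filter_upwards [R.isOpen_of_isChart h hz (continuous_sndPart.continuousAt.preimage_mem_nhds hW)]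
      with y hy
    obtain ⟨w, hw, rfl⟩ := hy
    rw [mem_preimage, ← R.snd_eq hw.1]
    exact hw.2
  bounded := by
    have : f '' X = (fun z : γ → ℝ => z ∘ fun b => e (Sum.inr b)) '' F := by
      rw [← R.image_fst, image_image]
      exact image_congr fun z hz => (R.snd_eq hz).symm
    rw [this]
    exact isBounded_image_comp hbd _

lemma exchangeLabel_inl (i : β) (j : α) (a : {a : α // a ≠ j}) :
    exchangeLabel i j (Sum.inl a) = Sum.inl a.1 := rfl

lemma exchangeLabel_inr_self (i : β) (j : α) :
    exchangeLabel i j (Sum.inr i) = Sum.inl j := by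
  simp [exchangeLabel]

lemma exchangeLabel_inr_of_ne {i l : β} (j : α) (h : l ≠ i) :
    exchangeLabel i j (Sum.inr l) = Sum.inr l := by
  simp [exchangeLabel, h]

lemma exchangeLabel_injective (i : β) (j : α) : Function.Injective (exchangeLabel i j) := by
  rintro (a | l) (a' | l') h
  · simp only [exchangeLabel_inl, Sum.inl.injEq] at h
    rw [Subtype.ext h]
  · by_cases hl : l' = i
    · subst hl
      rw [exchangeLabel_inl, exchangeLabel_inr_self] at h
      exact absurd (Sum.inl_injective h) a.2
    · rw [exchangeLabel_inl, exchangeLabel_inr_of_ne j hl] at h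
      cases h
  · by_cases hl : l = i
    · subst hl
      rw [exchangeLabel_inl, exchangeLabel_inr_self] at h
      exact absurd (Sum.inl_injective h).symm a'.2
    · rw [exchangeLabel_inl, exchangeLabel_inr_of_ne j hl] at h
      cases h
  · by_cases hl : l = i <;> by_cases hl' : l' = i
    · rw [hl, hl']
    · subst hl
      rw [exchangeLabel_inr_self, exchangeLabel_inr_of_ne j hl'] at h
      cases h
    · subst hl'
      rw [exchangeLabel_inr_self, exchangeLabel_inr_of_ne j hl] at h
      cases h
    · rw [exchangeLabel_inr_of_ne j hl, exchangeLabel_inr_of_ne j hl'] at h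
      rw [Sum.inr_injective h]

lemma range_exchangeLabel (i : β) (j : α) : range (exchangeLabel i j) = {Sum.inr i}ᶜ := by
  ext c
  simp only [mem_range, mem_compl_iff, mem_singleton_iff]
  constructor
  · rintro ⟨a | l, rfl⟩
    · simp [exchangeLabel_inl]
    · by_cases hl : l = i
      · subst hl
        simp [exchangeLabel_inr_self]
      · simpa [exchangeLabel_inr_of_ne j hl] using hl
  · intro hc
    rcases c with a | l
    · by_cases ha : a = j
      · subst ha
        exact ⟨Sum.inr i, exchangeLabel_inr_self i a⟩
      · exact ⟨Sum.inl ⟨a, ha⟩, rfl⟩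
    · exact ⟨Sum.inr l, exchangeLabel_inr_of_ne j fun he => hc (he ▸ rfl)⟩

lemma Realizes.levelSlice_eq (R : Realizes e S F X f) (i : β) (j : α) (b : ℝ) :
    levelSlice (graph X f) i j b =
      (fun z => z ∘ (e ∘ exchangeLabel i j)) '' level F (e (Sum.inr i)) b := by
  ext y
  constructor
  · rintro ⟨z, ⟨hz, hb⟩, rfl⟩
    rw [← R.image_eq] at hz
    obtain ⟨w, hw, rfl⟩ := hz
    exact ⟨w, ⟨hw, hb⟩, rfl⟩
  · rintro ⟨w, ⟨hw, hb⟩, rfl⟩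
    exact ⟨w ∘ e, ⟨R.image_eq ▸ ⟨w, hw, rfl⟩, hb⟩, rfl⟩

lemma Realizes.slice_mem_iff [DecidableEq γ] (R : Realizes e S F X f) (i : β) (j : α) (c : γ) :
    c ∈ S.erase (e (Sum.inl j)) ↔
      ∃ a : {a : α // a ≠ j}, (e ∘ exchangeLabel i j) (Sum.inl a) = c := by
  rw [Finset.mem_erase, R.mem_iff]
  constructor
  · rintro ⟨hne, a, rfl⟩
    exact ⟨⟨a, fun he => hne (he ▸ rfl)⟩, rfl⟩
  · rintro ⟨a, rfl⟩
    exact ⟨fun he => a.2 (Sum.inl_injective (R.injective he)), a.1, rfl⟩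

lemma Realizes.slice_constant (R : Realizes e S F X f) (i : β) (j : α) (b : ℝ) (c : γ)
    (hc : c ∉ range (e ∘ exchangeLabel i j)) : ∀ z ∈ level F (e (Sum.inr i)) b,
      ∀ w ∈ level F (e (Sum.inr i)) b, z c = w c := by
  intro z hz w hw
  by_cases hcr : c ∈ range e
  · obtain ⟨d, rfl⟩ := hcr
    by_cases hd : d = Sum.inr i
    · subst hd
      exact hz.2.trans hw.2.symm
    · have : d ∈ range (exchangeLabel i j) := by
        rw [range_exchangeLabel]
        exact hd
      obtain ⟨d', rfl⟩ := this
      exact absurd ⟨d', rfl⟩ hc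
  · exact R.constant c hcr z hz.1 w hw.1

lemma Realizes.slice [DecidableEq γ] (R : Realizes e S F X f) (i : β) (j : α) (b : ℝ)
    {X' : Set ({a : α // a ≠ j} → ℝ)} {f' : ({a : α // a ≠ j} → ℝ) → (β → ℝ)}
    (h : graph X' f' = levelSlice (graph X f) i j b) :
    Realizes (e ∘ exchangeLabel i j) (S.erase (e (Sum.inl j))) (level F (e (Sum.inr i)) b) X' f' :=
  ⟨R.injective.comp (exchangeLabel_injective i j), R.slice_mem_iff i j,
    by rw [h, R.levelSlice_eq], R.slice_constant i j b⟩

lemma Realizes.mem_basisSystem_iff [DecidableEq γ] (R : Realizes e S F X f)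
    {H : Finset (α ⊕ β)} :
    H ∈ basisSystem X f ↔ H.card = Nat.card α ∧ Separates (H.image e) F := by
  have hval : ∀ z ∈ F, ∀ d, Sum.elim (fstPart e z) (f (fstPart e z)) d = z (e d) := by
    rintro z hz (a | b)
    · rfl
    · exact (congrFun (R.snd_eq hz) b).symm
  refine and_congr_right fun _ => ?_
  constructor
  · intro h z hz w hw ha
    refine R.ext hz hw (h (R.fst_mem hz) (R.fst_mem hw) ?_)
    funext d
    simp only [hval z hz, hval w hw]
    exact ha _ (Finset.mem_image_of_mem e d.2)
  · intro h x hx y hy hxy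
    obtain ⟨z, hz, rfl⟩ := R.exists_mem hx
    obtain ⟨w, hw, rfl⟩ := R.exists_mem hy
    rw [h z hz w hw]
    intro c hc
    obtain ⟨d, hd, rfl⟩ := Finset.mem_image.1 hc
    have := congrFun hxy ⟨d, hd⟩
    simpa only [hval z hz, hval w hw] using this

/-- A set separated by the coordinates in `S` is a graph. -/
lemma exists_realizes (he : Function.Injective e) (hS : ∀ c, c ∈ S ↔ ∃ a, e (Sum.inl a) = c)
    (hs : Separates S F) (hc : ∀ c, c ∉ range e → ∀ z ∈ F, ∀ w ∈ F, z c = w c) :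
    ∃ f : (α → ℝ) → (β → ℝ), Realizes e S F (fstPart e '' F) f := by
  classical
  refine ⟨fun x => if hx : x ∈ fstPart e '' F then sndPart e hx.choose else 0, he, hS, ?_, hc⟩
  have key : ∀ z ∈ F, (if hx : fstPart e z ∈ fstPart e '' F then sndPart e hx.choose else 0) =
      sndPart e z := by
    intro z hz
    have hx : fstPart e z ∈ fstPart e '' F := ⟨z, hz, rfl⟩
    rw [dif_pos hx]
    obtain ⟨h1, h2⟩ := hx.choose_spec
    rw [hs _ h1 z hz fun c hc => ?_]
    obtain ⟨a, rfl⟩ := (hS c).1 hc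
    exact congrFun h2 a
  ext y
  constructor
  · rintro ⟨z, hz, rfl⟩
    exact ⟨⟨z, hz, rfl⟩, (key z hz).symm⟩
  · rintro ⟨⟨z, hz, h1⟩, h2⟩
    refine ⟨z, hz, funext fun d => ?_⟩
    have h2' : y ∘ Sum.inr = sndPart e z := by
      rw [h2, ← h1]
      exact key z hz
    cases d with
    | inl a => exact congrFun h1 a
    | inr b => exact (congrFun h2' b).symm

lemma isChart_empty_of_subsingleton {G : Set (γ → ℝ)} (hne : G.Nonempty) (h : G.Subsingleton) :
    IsChart ∅ G where
  nonempty := hne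
  separates := fun z hz w hw _ => h hz hw
  isOpen := fun z hz U hU => Eventually.of_forall fun x =>
    ⟨z, ⟨hz, mem_of_mem_nhds hU⟩, by simp [Agree]⟩
  connected := fun J σ c _ => (h.anti inter_subset_left).isPreconnected

/-- The graph of a monotone map is a monotone chart. -/
theorem Realizes.isMonotoneChart [DecidableEq γ] {L : FirstOrder.Language.{u, v}} [L.Structure ℝ]
    {n : ℕ} (R : Realizes e S F X f) (hα : Nat.card α = n + 1)
    (h : IsMonotoneMapOfDim L (n + 1) X f) : IsMonotoneChart (n + 1) S F := by
  induction n generalizing α S F X with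
  | zero =>
    obtain ⟨hb, hm⟩ := h
    refine ⟨R.card_eq.trans hα, R.isChart hb, fun c hc d hd hdep => ?_⟩
    obtain ⟨j, rfl⟩ := (R.mem_iff d).1 hd
    obtain ⟨i, rfl⟩ : ∃ i, e (Sum.inr i) = c := by
      by_contra hno
      obtain ⟨z, hz, w, hw, -, hne⟩ := hdep
      refine hne (R.constant c ?_ z hz w hw)
      rintro ⟨a | i, rfl⟩
      · exact hc (R.inl_mem a)
      · exact hno ⟨i, rfl⟩
    obtain ⟨hsub, -⟩ := Nat.card_eq_one_iff_unique.1 hα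
    have hss : ∀ b, (level F (e (Sum.inr i)) b).Subsingleton := by
      intro b z hz w hw
      refine R.ext hz.1 hw.1 (funext fun a => ?_)
      have hfz := congrFun (R.snd_eq hz.1) i
      have hfw := congrFun (R.snd_eq hw.1) i
      have hfe : f (fstPart e z) i = f (fstPart e w) i := by
        rw [← hfz, ← hfw]
        exact hz.2.trans hw.2.symm
      have hoff : ∀ x y : α → ℝ, AgreeOff j x y := fun x y l hl =>
        absurd (Subsingleton.elim l j) hl
      rw [Subsingleton.elim a j]
      rcases (hm i).coordinates j with hmono | hmono | hmono
      · rcases lt_trichotomy (fstPart e z j) (fstPart e w j) with hlt | heq | hlt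
        · exact absurd hfe (hmono _ (R.fst_mem hz.1) _ (R.fst_mem hw.1) (hoff _ _) hlt).ne
        · exact heq
        · exact absurd hfe (hmono _ (R.fst_mem hw.1) _ (R.fst_mem hz.1) (hoff _ _) hlt).ne'
      · rcases lt_trichotomy (fstPart e z j) (fstPart e w j) with hlt | heq | hlt
        · exact absurd hfe (hmono _ (R.fst_mem hz.1) _ (R.fst_mem hw.1) (hoff _ _) hlt).ne'
        · exact heq
        · exact absurd hfe (hmono _ (R.fst_mem hw.1) _ (R.fst_mem hz.1) (hoff _ _) hlt).ne
      · exact absurd hmono (R.dependsOn_iff.1 hdep)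
    have hS : S.erase (e (Sum.inl j)) = ∅ := by
      rw [← Finset.card_eq_zero, Finset.card_erase_of_mem hd, R.card_eq, hα]
    rw [hS]
    exact ⟨fun b hb => ⟨rfl, isChart_empty_of_subsingleton hb (hss b)⟩,
      fun H _ _ b b' _ _ z hz w hw _ => hss b' hz hw⟩
  | succ n ih =>
    obtain ⟨hb, hm⟩ := h
    have hfin : Finite α := Nat.finite_of_card_ne_zero (by omega)
    refine ⟨R.card_eq.trans hα, R.isChart hb, fun c hc d hd hdep => ?_⟩
    obtain ⟨j, rfl⟩ := (R.mem_iff d).1 hd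
    obtain ⟨i, rfl⟩ : ∃ i, e (Sum.inr i) = c := by
      by_contra hno
      obtain ⟨z, hz, w, hw, -, hne⟩ := hdep
      refine hne (R.constant c ?_ z hz w hw)
      rintro ⟨a | i, rfl⟩
      · exact hc (R.inl_mem a)
      · exact hno ⟨i, rfl⟩
    obtain ⟨m, hm⟩ := hm i j (R.dependsOn_iff.1 hdep)
    have hcard : Nat.card {a : α // a ≠ j} = n + 1 := by
      have := Fintype.ofFinite α
      classical
      rw [Nat.card_eq_fintype_card] at hα ⊢
      rw [Fintype.card_subtype_compl, Fintype.card_subtype_eq, hα]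
      rfl
    have hne : ∀ b, (level F (e (Sum.inr i)) b).Nonempty →
        (levelSlice (graph X f) i j b).Nonempty := by
      intro b hb
      rw [R.levelSlice_eq]
      exact hb.image _
    have hmono : ∀ b, (level F (e (Sum.inr i)) b).Nonempty →
        IsMonotoneChart (n + 1) (S.erase (e (Sum.inl j))) (level F (e (Sum.inr i)) b) := by
      intro b hb
      obtain ⟨X', f', h1, h2, h3⟩ := hm b (hne b hb)
      exact ih (R.slice i j b h2) hcard h1
    refine ⟨hmono, fun H hiH hH b b' hb hs => ?_⟩
    rcases (level F (e (Sum.inr i)) b').eq_empty_or_nonempty with hb' | hb'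
    · rw [hb']
      exact fun z hz => absurd hz (notMem_empty z)
    obtain ⟨X₁, f₁, -, h₁, hm₁⟩ := hm b (hne b hb)
    obtain ⟨X₂, f₂, -, h₂, hm₂⟩ := hm b' (hne b' hb')
    have R₁ := R.slice i j b h₁
    have R₂ := R.slice i j b' h₂
    have hrange : ∀ c ∈ H, c ∈ range (e ∘ exchangeLabel i j) := by
      intro c hc
      by_contra hcr
      have hs' : Separates (H.erase c) (level F (e (Sum.inr i)) b) := by
        intro z hz w hw ha
        refine hs z hz w hw fun k hk => ?_
        by_cases hkc : k = c
        · subst hkc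
          exact R₁.constant _ hcr z hz w hw
        · exact ha k (Finset.mem_erase.2 ⟨hkc, hk⟩)
      have := (hmono b hb).le_card hs'
      rw [Finset.card_erase_of_mem hc] at this
      omega
    have hinj := R₁.injective
    obtain ⟨H', rfl⟩ : ∃ H' : Finset ({a : α // a ≠ j} ⊕ β),
        H'.image (e ∘ exchangeLabel i j) = H := by
      classical
      refine ⟨H.preimage _ hinj.injOn, ?_⟩
      rw [Finset.image_preimage]
      exact Finset.filter_true_of_mem hrange
    rw [Finset.card_image_of_injective _ hinj] at hH
    have hmem : H' ∈ basisSystem X₂ f₂ := by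
      rw [hm₂, ← hm₁, R₁.mem_basisSystem_iff]
      exact ⟨hH.trans hcard.symm, hs⟩
    exact (R₂.mem_basisSystem_iff.1 hmem).2

end Realization

section Definable

variable {γ : Type} {L : FirstOrder.Language.{u, v}} [L.Structure ℝ]

lemma definable_coord_eq (c : γ) (b : ℝ) : (univ : Set ℝ).Definable L {z : γ → ℝ | z c = b} :=
  (Definable.singleton_of_mem L (mem_univ b)).preimage_comp fun _ : Fin 1 => c

lemma IsOMinimal.definable_coord_lt [Finite γ] (hL : IsOMinimal L) (c : γ) (b : ℝ) :
    (univ : Set ℝ).Definable L {z : γ → ℝ | z c < b} := by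
  have h1 : (univ : Set ℝ).Definable L {y : γ ⊕ Unit → ℝ | y (Sum.inl c) < y (Sum.inr ())} :=
    hL.definable_lt.preimage_comp ![Sum.inl c, Sum.inr ()]
  have h2 := (h1.inter (definable_coord_eq (Sum.inr ()) b)).image_comp Sum.inl
  convert h2 using 1
  ext z
  constructor
  · intro hz
    exact ⟨Sum.elim z fun _ => b, ⟨hz, rfl⟩, rfl⟩
  · rintro ⟨y, ⟨h1, h2⟩, rfl⟩
    have h1' : y (Sum.inl c) < y (Sum.inr ()) := h1
    have h2' : y (Sum.inr ()) = b := h2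
    rwa [h2'] at h1'

lemma IsOMinimal.definable_coord_gt [Finite γ] (hL : IsOMinimal L) (c : γ) (b : ℝ) :
    (univ : Set ℝ).Definable L {z : γ → ℝ | b < z c} := by
  have := (hL.definable_coord_lt c b).compl.inter (definable_coord_eq c b).compl
  convert this using 1
  ext z
  simp only [mem_ofPred_eq, mem_inter_iff, mem_compl_iff, not_lt]
  exact ⟨fun h => ⟨h.le, h.ne'⟩, fun h => lt_of_le_of_ne h.1 (Ne.symm h.2)⟩

end Definable

section OneVariable

variable {α : Type} {L : FirstOrder.Language.{u, v}} [L.Structure ℝ]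

lemma isPreconnected_of_subsingleton_index [Subsingleton α] (a : α) {X : Set (α → ℝ)}
    (h : ∀ x ∈ X, ∀ y ∈ X, ∀ z : α → ℝ, x a ≤ z a → z a ≤ y a → z ∈ X) : IsPreconnected X := by
  have hconst : ∀ x : α → ℝ, (fun _ => x a) = x := fun x =>
    funext fun b => by rw [Subsingleton.elim b a]
  have hord : ((fun x : α → ℝ => x a) '' X).OrdConnected := by
    refine ⟨?_⟩
    rintro _ ⟨x, hx, rfl⟩ _ ⟨y, hy, rfl⟩ t ht
    exact ⟨fun _ => t, h x hx y hy _ ht.1 ht.2, rfl⟩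
  have := hord.isPreconnected.image (fun (t : ℝ) (_ : α) => t) (by fun_prop)
  rw [image_image] at this
  simpa only [hconst, image_id'] using this

lemma mem_of_isPreconnected [Subsingleton α] {a : α} {X : Set (α → ℝ)} (h : IsPreconnected X)
    {x y z : α → ℝ} (hx : x ∈ X) (hy : y ∈ X) (h1 : x a ≤ z a) (h2 : z a ≤ y a) : z ∈ X := by
  have hord := (h.image _ (continuous_apply a).continuousOn).ordConnected
  obtain ⟨w, hw, hwz⟩ := hord.out ⟨x, hx, rfl⟩ ⟨y, hy, rfl⟩ ⟨h1, h2⟩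
  have : w = z := funext fun b => by
    rw [Subsingleton.elim b a]
    exact hwz
  exact this ▸ hw

lemma IsSemiMonotone.isPreconnected {X : Set (α → ℝ)} (h : IsSemiMonotone L X) :
    IsPreconnected X := by
  have := h.connected univ ⟨∅, fun _ => Ordering.eq, 0, by simp⟩
  rwa [inter_univ] at this

/-- A continuous function of one variable that is strictly monotone or constant is submonotone. -/
lemma isSubmonotone_of_subsingleton [Subsingleton α] (a : α) {X : Set (α → ℝ)}
    {g : (α → ℝ) → ℝ} (hne : X.Nonempty) (hX : IsSemiMonotone L X)
    (hbd : Bornology.IsBounded (g '' X)) (hg : ContinuousOn g X)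
    (hdef : ∀ b, (univ : Set ℝ).Definable L {x | x ∈ X ∧ g x < b})
    (hm : StrictlyIncreasingIn X g a ∨ StrictlyDecreasingIn X g a ∨ IndependentOf X g a) :
    IsSubmonotone L X g where
  nonempty := hne
  domain := hX
  bounded := hbd
  upperSemicontinuous := hg.upperSemicontinuousOn
  sublevel := by
    intro b
    refine ⟨hdef b, hg.isOpen_inter_preimage hX.isOpen isOpen_Iio,
      hX.bounded.subset fun x hx => hx.1, ?_⟩
    rintro C ⟨J, σ, c, rfl⟩
    have hoff : ∀ x y : α → ℝ, AgreeOff a x y := fun x y l hl =>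
      absurd (Subsingleton.elim l a) hl
    refine isPreconnected_of_subsingleton_index a ?_
    rintro x ⟨⟨hx, hxb⟩, hxC⟩ y ⟨⟨hy, hyb⟩, hyC⟩ z hxz hzy
    have hz : z ∈ X := mem_of_isPreconnected hX.isPreconnected hx hy hxz hzy
    have hext : ∀ w w' : α → ℝ, w a = w' a → w = w' := fun w w' h =>
      funext fun l => by rwa [Subsingleton.elim l a]
    refine ⟨⟨hz, ?_⟩, fun j hj => ?_⟩
    · rcases hm with hm | hm | hm
      · rcases hzy.lt_or_eq with h | h
        · exact (hm z hz y hy (hoff _ _) h).trans hyb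
        · rwa [hext z y h]
      · rcases hxz.lt_or_eq with h | h
        · exact (hm x hx z hz (hoff _ _) h).trans hxb
        · rwa [← hext x z h]
      · rwa [← hm x hx z hz (hoff _ _)]
    · have h1 := hxC j hj
      have h2 := hyC j hj
      have hxz' : x j ≤ z j := by rwa [Subsingleton.elim j a]
      have hzy' : z j ≤ y j := by rwa [Subsingleton.elim j a]
      cases hσ : σ j with
      | lt =>
        rw [hσ] at h2
        exact lt_of_le_of_lt hzy' h2
      | eq =>
        rw [hσ] at h1 h2
        exact le_antisymm (hzy'.trans (le_of_eq h2)) (ge_trans hxz' (ge_of_eq h1))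
      | gt =>
        rw [hσ] at h1
        exact lt_of_lt_of_le h1 hxz'

/-- An injective continuous function of one variable is strictly monotone. -/
lemma strictlyMonotone_of_injOn [Subsingleton α] (a : α) {X : Set (α → ℝ)} {g : (α → ℝ) → ℝ}
    (hX : IsPreconnected X) (hg : ContinuousOn g X) (hi : InjOn g X) :
    StrictlyIncreasingIn X g a ∨ StrictlyDecreasingIn X g a := by
  by_contra hno
  rw [not_or] at hno
  simp only [StrictlyIncreasingIn, StrictlyDecreasingIn, not_forall, not_lt] at hno
  obtain ⟨⟨x, hx, y, hy, -, hxy, h1⟩, ⟨x', hx', y', hy', -, hxy', h2⟩⟩ := hno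
  have hconst : ∀ x : α → ℝ, (fun _ => x a) = x := fun x =>
    funext fun b => by rw [Subsingleton.elim b a]
  have hsub : ∀ t ∈ Icc (min (x a) (x' a)) (max (y a) (y' a)), (fun _ : α => t) ∈ X := by
    intro t ht
    have hl : ∃ w ∈ X, w a ≤ t := by
      rcases le_total (x a) (x' a) with h | h
      · exact ⟨x, hx, by simpa [h] using ht.1⟩
      · exact ⟨x', hx', by simpa [h] using ht.1⟩
    have hr : ∃ w ∈ X, t ≤ w a := by
      rcases le_total (y a) (y' a) with h | h
      · exact ⟨y', hy', by simpa [h] using ht.2⟩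
      · exact ⟨y, hy, by simpa [h] using ht.2⟩
    obtain ⟨w, hw, hwt⟩ := hl
    obtain ⟨w', hw', hwt'⟩ := hr
    exact mem_of_isPreconnected hX hw hw' hwt hwt'
  have hxm : x a ∈ Icc (min (x a) (x' a)) (max (y a) (y' a)) :=
    ⟨min_le_left _ _, hxy.le.trans (le_max_left _ _)⟩
  have hym : y a ∈ Icc (min (x a) (x' a)) (max (y a) (y' a)) :=
    ⟨(min_le_left _ _).trans hxy.le, le_max_left _ _⟩
  have hxm' : x' a ∈ Icc (min (x a) (x' a)) (max (y a) (y' a)) :=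
    ⟨min_le_right _ _, hxy'.le.trans (le_max_right _ _)⟩
  have hym' : y' a ∈ Icc (min (x a) (x' a)) (max (y a) (y' a)) :=
    ⟨(min_le_right _ _).trans hxy'.le, le_max_right _ _⟩
  have hc : ContinuousOn (fun t : ℝ => g fun _ => t)
      (Icc (min (x a) (x' a)) (max (y a) (y' a))) :=
    hg.comp (by fun_prop) hsub
  have hinj : InjOn (fun t : ℝ => g fun _ => t)
      (Icc (min (x a) (x' a)) (max (y a) (y' a))) := fun s hs t ht hst =>
    congrFun (hi (hsub s hs) (hsub t ht) hst) a
  rcases hc.strictMonoOn_of_injOn_Icc' (hxm.1.trans hxm.2) hinj with h | h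
  · have := h hxm hym hxy
    simp only [hconst] at this
    linarith
  · have := h hxm' hym' hxy'
    simp only [hconst] at this
    linarith

end OneVariable

section Realization

variable {α β γ : Type} {e : α ⊕ β → γ} {S : Finset γ} {F : Set (γ → ℝ)}
  {X : Set (α → ℝ)} {f : (α → ℝ) → (β → ℝ)}

lemma Realizes.definable_inter [Finite α] [Finite γ] (R : Realizes e S F X f)
    {L : FirstOrder.Language.{u, v}} [L.Structure ℝ] (hdef : (univ : Set ℝ).Definable L F)
    (i : β) {T : Set ℝ}
    (hT : (univ : Set ℝ).Definable L {z : γ → ℝ | z (e (Sum.inr i)) ∈ T}) :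
    (univ : Set ℝ).Definable L {x | x ∈ X ∧ f x i ∈ T} := by
  have := (hdef.inter hT).image_comp fun a => e (Sum.inl a)
  convert this using 1
  ext x
  constructor
  · rintro ⟨hx, hxT⟩
    obtain ⟨z, hz, rfl⟩ := R.exists_mem hx
    refine ⟨z, ⟨hz, ?_⟩, rfl⟩
    change sndPart e z i ∈ T
    rwa [R.snd_eq hz]
  · rintro ⟨z, ⟨hz, hzT⟩, rfl⟩
    refine ⟨R.fst_mem hz, ?_⟩
    change f (fstPart e z) i ∈ T
    rw [← R.snd_eq hz]
    exact hzT

lemma Realizes.isMonotoneFunction [DecidableEq γ] [Finite α] [Finite β] [Finite γ]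
    (R : Realizes e S F X f) {L : FirstOrder.Language.{u, v}} [L.Structure ℝ]
    (hL : IsOMinimal L) (hdef : (univ : Set ℝ).Definable L F) (hbd : Bornology.IsBounded F)
    (h : IsMonotoneChart 1 S F) (i : β) : IsMonotoneFunction L X fun x => f x i := by
  have hb := R.isBoundedContinuousMap hdef hbd h.isChart
  obtain ⟨hsub, ⟨a⟩⟩ := Nat.card_eq_one_iff_unique.1 (R.card_eq.symm.trans h.card_eq)
  have hc : ContinuousOn (fun x => f x i) X := (continuous_apply i).comp_continuousOn hb.continuous
  have hbi : Bornology.IsBounded ((fun x => f x i) '' X) := by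
    have := Bornology.IsBounded.image_eval hb.bounded i
    rwa [image_image] at this
  have hmono : StrictlyIncreasingIn X (fun x => f x i) a ∨
      StrictlyDecreasingIn X (fun x => f x i) a ∨ IndependentOf X (fun x => f x i) a := by
    by_cases hind : IndependentOf X (fun x => f x i) a
    · exact Or.inr (Or.inr hind)
    · have hd := R.dependsOn_iff.2 hind
      have hs := h.separates_exchange (R.inr_notMem i) (R.inl_mem a) hd
      have hinj : InjOn (fun x => f x i) X := by
        intro x hx y hy hxy
        obtain ⟨z, hz, rfl⟩ := R.exists_mem hx
        obtain ⟨w, hw, rfl⟩ := R.exists_mem hy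
        rw [hs z hz w hw fun c hc => ?_]
        rcases Finset.mem_insert.1 hc with rfl | hc
        · change sndPart e z i = sndPart e w i
          rw [R.snd_eq hz, R.snd_eq hw]
          exact hxy
        · exact R.agree_erase_iff.2 (fun l hl => absurd (Subsingleton.elim l a) hl) c hc
      rcases strictlyMonotone_of_injOn a hb.domain.isPreconnected hc hinj with h | h
      · exact Or.inl h
      · exact Or.inr (Or.inl h)
  refine ⟨?_, ?_, ?_, fun j => ?_⟩
  · have := hb.definable.image_comp (Sum.map id fun _ : Unit => i)
    convert this using 1
    ext y
    constructor
    · rintro ⟨h1, h2⟩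
      refine ⟨Sum.elim (y ∘ Sum.inl) (f (y ∘ Sum.inl)), ⟨h1, rfl⟩, funext fun d => ?_⟩
      rcases d with d | d
      · rfl
      · exact (congrFun h2 d).symm
    · rintro ⟨z, ⟨h1, h2⟩, rfl⟩
      exact ⟨h1, funext fun _ => congrFun h2 i⟩
  · exact isSubmonotone_of_subsingleton a hb.nonempty hb.domain hbi hc
      (fun b => R.definable_inter hdef i (T := Iio b) (hL.definable_coord_lt _ b)) hmono
  · refine isSubmonotone_of_subsingleton a hb.nonempty hb.domain ?_ hc.neg (fun b => ?_) ?_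
    · rw [← image_image (fun t : ℝ => -t) (fun x => f x i), image_neg_eq_neg]
      exact hbi.neg
    · have := R.definable_inter hdef i (T := Ioi (-b)) (hL.definable_coord_gt _ (-b))
      convert this using 1
      ext x
      simp [neg_lt]
    · rcases hmono with h | h | h
      · exact Or.inr (Or.inl fun x hx y hy ha hxy => neg_lt_neg (h x hx y hy ha hxy))
      · exact Or.inl fun x hx y hy ha hxy => neg_lt_neg (h x hx y hy ha hxy)
      · exact Or.inr (Or.inr fun x hx y hy ha => congrArg Neg.neg (h x hx y hy ha))
  · rw [Subsingleton.elim j a]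
    exact hmono

/-- A definable bounded monotone chart is the graph of a monotone map. -/
theorem Realizes.isMonotoneMapOfDim [DecidableEq γ] [Finite α] [Finite β] [Finite γ]
    (R : Realizes e S F X f) {L : FirstOrder.Language.{u, v}} [L.Structure ℝ]
    (hL : IsOMinimal L) {n : ℕ} (hdef : (univ : Set ℝ).Definable L F)
    (hbd : Bornology.IsBounded F) (h : IsMonotoneChart (n + 1) S F) :
    IsMonotoneMapOfDim L (n + 1) X f := by
  induction n generalizing α S F X with
  | zero =>
    exact ⟨R.isBoundedContinuousMap hdef hbd h.isChart,
      fun i => R.isMonotoneFunction hL hdef hbd h i⟩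
  | succ n ih =>
    refine ⟨R.isBoundedContinuousMap hdef hbd h.isChart, fun i j hind => ?_⟩
    obtain ⟨h1, h2⟩ := h.2.2 _ (R.inr_notMem i) _ (R.inl_mem j) (R.dependsOn_iff.2 hind)
    refine ⟨{H | H.card = Nat.card {a : α // a ≠ j} ∧
      ∀ b, Separates (H.image (e ∘ exchangeLabel i j)) (level F (e (Sum.inr i)) b)},
      fun b hb => ?_⟩
    rw [R.levelSlice_eq] at hb ⊢
    have hb' := image_nonempty.1 hb
    have hinj := R.injective.comp (exchangeLabel_injective i j)
    obtain ⟨f', R'⟩ := exists_realizes hinj (R.slice_mem_iff i j)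
      (h1 b hb').isChart.separates (R.slice_constant i j b)
    refine ⟨_, f', ih R' (hdef.inter (definable_coord_eq _ b))
      (hbd.subset (level_subset _ _ _)) (h1 b hb'), R'.image_eq.symm, ?_⟩
    ext H
    rw [R'.mem_basisSystem_iff]
    refine and_congr_right fun hH => ⟨fun hs b' => ?_, fun hs => hs b⟩
    refine h2 _ ?_ ?_ b b' hb' hs
    · intro hm
      obtain ⟨d, -, hd⟩ := Finset.mem_image.1 hm
      have hd' : exchangeLabel i j d ∈ range (exchangeLabel i j) := ⟨d, rfl⟩
      rw [R.injective hd, range_exchangeLabel] at hd'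
      exact hd' rfl
    · rw [Finset.card_image_of_injective _ hinj, hH, ← R'.card_eq]
      exact (h1 b hb').card_eq

end Realization

end MonotoneMaps

open MonotoneMaps in
theorem theorem3p10 (L : FirstOrder.Language.{u, v}) [L.Structure ℝ]
    (hL : MonotoneMaps.IsOMinimal L) (n k : ℕ)
    (X : Set (Fin n → ℝ)) (f : (Fin n → ℝ) → (Fin k → ℝ))
    (hf : MonotoneMaps.IsMonotoneMap L X f)
    (H : Finset (Fin n ⊕ Fin k)) (hH : H ∈ MonotoneMaps.basisSystem X f) :
    MonotoneMaps.IsSemiMonotone L (MonotoneMaps.proj H (MonotoneMaps.graph X f)) ∧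
    ∃ g : ({c // c ∈ H} → ℝ) → ({c // c ∉ H} → ℝ),
      MonotoneMaps.IsMonotoneMap L (MonotoneMaps.proj H (MonotoneMaps.graph X f)) g ∧
      MonotoneMaps.graph X f =
        {z : Fin n ⊕ Fin k → ℝ |
          (fun c : {c // c ∈ H} => z c.1) ∈ MonotoneMaps.proj H (MonotoneMaps.graph X f) ∧
          (fun c : {c // c ∉ H} => z c.1) = g (fun c : {c // c ∈ H} => z c.1)} := by
  cases n with
  | zero =>
    rw [IsMonotoneMap, Nat.card_eq_fintype_card, Fintype.card_fin] at hf
    exact hf.elim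
  | succ n =>
    have hα : Nat.card (Fin (n + 1)) = n + 1 := by simp
    rw [IsMonotoneMap, hα] at hf
    have hb : IsBoundedContinuousMap L X f := by
      cases n with
      | zero => exact hf.1
      | succ n => exact hf.1
    have R : Realizes (id : Fin (n + 1) ⊕ Fin k → _) (Finset.univ.image Sum.inl) (graph X f) X f :=
      ⟨Function.injective_id, by simp, by simp, fun c hc => absurd (by simp) hc⟩
    have hbd : Bornology.IsBounded (graph X f) := by
      rw [← Bornology.forall_isBounded_image_eval_iff]
      rintro (a | b)
      · refine (hb.domain.bounded.image_eval a).subset ?_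
        rintro _ ⟨z, hz, rfl⟩
        exact ⟨_, hz.1, rfl⟩
      · refine (hb.bounded.image_eval b).subset ?_
        rintro _ ⟨z, hz, rfl⟩
        exact ⟨_, ⟨_, hz.1, rfl⟩, congrFun hz.2.symm b⟩
    obtain ⟨hcard, hsep⟩ := R.mem_basisSystem_iff.1 hH
    rw [Finset.image_id] at hsep
    have hchart := (R.isMonotoneChart hα hf).of_separates hsep (hcard.trans hα)
    have hsurj : ∀ c, c ∈ Set.range (Sum.elim Subtype.val Subtype.val :
        {c // c ∈ H} ⊕ {c // c ∉ H} → Fin (n + 1) ⊕ Fin k) := by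
      intro c
      by_cases hc : c ∈ H
      · exact ⟨Sum.inl ⟨c, hc⟩, rfl⟩
      · exact ⟨Sum.inr ⟨c, hc⟩, rfl⟩
    obtain ⟨g, R'⟩ := exists_realizes
      (e := (Sum.elim Subtype.val Subtype.val :
        {c // c ∈ H} ⊕ {c // c ∉ H} → Fin (n + 1) ⊕ Fin k)) (S := H) (F := graph X f)
      (Subtype.val_injective.sumElim Subtype.val_injective fun a b he => b.2 (he ▸ a.2))
      (fun c => ⟨fun hc => ⟨⟨c, hc⟩, rfl⟩, fun ⟨a, ha⟩ => ha ▸ a.2⟩) hsep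
      (fun c hc => absurd (hsurj c) hc)
    have hmap := R'.isMonotoneMapOfDim hL hb.definable hbd hchart
    refine ⟨(R'.isBoundedContinuousMap hb.definable hbd hchart.isChart).domain, g, ?_, ?_⟩
    · rw [IsMonotoneMap, Nat.card_eq_fintype_card, Fintype.card_coe, hcard, hα]
      exact hmap
    · ext z
      constructor
      · exact fun hz => ⟨R'.fst_mem hz, R'.snd_eq hz⟩
      · rintro ⟨⟨w, hw, hwz⟩, hz⟩
        have hz' : (fun c : {c // c ∉ H} => z c.1) = fun c => w c.1 :=
          hz.trans ((congrArg g hwz.symm).trans (R'.snd_eq hw).symm)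
        have : z = w := by
          funext c
          by_cases hc : c ∈ H
          · exact (congrFun hwz ⟨c, hc⟩).symm
          · exact congrFun hz' ⟨c, hc⟩
        exact this ▸ hw
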